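/- Let $a\in W^{1,\infty}(\mathbb S^1,\mathbb R)$ and let $\mathbf A\in W^{1,\infty}(\mathbb S^1,\mathbb R^2)$ be a transversal field, $\mathbf A(\omega)\cdot\omega=0$ for all $\omega\in\mathbb S^1$ (Lipschitz representatives are used). Put $A(\theta)=\mathbf A(\cos\theta,\sin\theta)\cdot(-\sin\theta,\cos\theta)$, $\widetilde A=\frac1{2\pi}\int_0^{2\pi}A(s)\,ds$, $\widetilde a=\frac1{2\pi}\int_0^{2\pi}a(\cos s,\sin s)\,ds$, and assume $\widetilde A\notin\frac12\mathbb Z$. Identify functions on $\mathbb S^1$ with $2\pi$-periodic functions of $\theta$. The operator $L_{\mathbf A,a}=(-i\nabla_{\mathbb S^1}+\mathbf A)^2+a$ on $\mathbb S^1$ has real eigenvalues $\mu_1\le\mu_2\le\cdots\to+\infty$, each repeated according to its finite multiplicity, and there exist $k^*,\ell\in\mathbb N$, real numbers $\lambda_j$, functions $\phi_j$ on $\mathbb S^1$ and functions $R_j:\mathbb R\to\mathbb C$ ($j\in\mathbb Z$, $|j|\ge\ell$) such that: (i) $\{\mu_k:k>k^*\}=\{\lambda_j:|j|\ge\ell\}$,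 where the $\mu_k$ with $k>k^*$ are pairwise distinct and the $\lambda_j$ with $|j|\ge\ell$ are pairwise distinct; (ii) as $|j|\to\infty$, $\sqrt{\lambda_j-\widetilde a}=(\operatorname{sgn}j)\big(\widetilde A-\lfloor\widetilde A+\tfrac12\rfloor\big)+|j|+O(|j|^{-3})$ and $\lambda_j=\widetilde a+\big(j+\widetilde A-\lfloor\widetilde A+\tfrac12\rfloor\big)^2+O(j^{-2})$; (iii) for $|j|\ge\ell$, $\phi_j$ is an $L^2(\mathbb S^1)$-normalized eigenfunction of $L_{\mathbf A,a}$ for $\lambda_j$, and for all $\theta\in\mathbb R$ $$\phi_j(\theta)=\tfrac1{\sqrt{2\pi}}\,e^{-i\left(\lfloor\widetilde A+1/2\rfloor\theta+\int_0^\theta A(t)\,dt\right)}\big(e^{i(\widetilde A+j)\theta}+R_j(\theta)\big),\qquad \sup_{\theta}|R_j(\theta)|=O(|j|^{-1})\ \text{ as }|j|\to\infty.$$ Moreover, assume $\mu_1>0$ and let $k^*,\ell,\lambda_j,\phi_j,R_j$ be any data satisfying (i)-(iii). For $k\le k^*$ let $\psi_k$ be any $L^2(\mathbb S^1)$-normalized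 eigenfunction of $L_{\mathbf A,a}$ for $\mu_k$, and for $k>k^*$ let $\psi_k=\phi_j$, where $\mu_k=\lambda_j$. Define $$K(x,y)=\sum_{k=1}^\infty i^{-\sqrt{\mu_k}}J_{\sqrt{\mu_k}}(|x||y|)\,\psi_k\big(\tfrac{x}{|x|}\big)\overline{\psi_k\big(\tfrac{y}{|y|}\big)},\qquad i^{-\beta}=e^{-i\pi\beta/2},$$ where $J_\nu$ is the Bessel function of the first kind (all terms vanish if $x=0$ or $y=0$). Then for all $r,r'\ge0$ and $\theta,\theta'\in\mathbb R$, with $x=(r\cos\theta,r\sin\theta)$ and $y=(r'\cos\theta',r'\sin\theta')$, the series defining $K(x,y)$ and the series below converge absolutely, and $$K(x,y)=\sum_{k=1}^{k^*}i^{-\sqrt{\mu_k}}J_{\sqrt{\mu_k}}(rr')\psi_k(\theta)\overline{\psi_k(\theta')}$$ $$\quad+\frac1{2\pi}\,e^{-i\int_{\theta'}^{\theta}A(s)\,ds}\,e^{-i\lfloor\widetilde A+\frac12\rfloor(\theta-\theta')}\sum_{|j|\ge\ell}i^{-\sqrt{\lambda_j}}J_{\sqrt{\lambda_j}}(rr')\big(e^{i(\widetilde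 A+j)\theta}+R_j(\theta)\big)\big(e^{-i(\widetilde A+j)\theta'}+\overline{R_j(\theta')}\big).$$ -/

import Mathlib

open scoped ComplexConjugate
open Asymptotics Filter

noncomputable section

/-- The Euclidean plane `ℝ²`. -/
abbrev Plane : Type := EuclideanSpace ℝ (Fin 2)

/-- The unit circle `𝕊¹ ⊂ ℝ²`. -/
abbrev UnitCircle : Type := Metric.sphere (0 : Plane) 1

/-- The point `(cos θ, sin θ)` of `𝕊¹`. -/
def pt (θ : ℝ) : UnitCircle :=
  ⟨!₂[Real.cos θ, Real.sin θ], by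
    simp [EuclideanSpace.norm_eq]⟩

/-- The unit tangent vector `(-sin θ, cos θ)` at `(cos θ, sin θ)`. -/
def tangent (θ : ℝ) : Plane := !₂[-Real.sin θ, Real.cos θ]

/-- `A(θ) = Avec(cos θ, sin θ) · (-sin θ, cos θ)`. -/
def angularComponent (Avec : UnitCircle → Plane) (θ : ℝ) : ℝ :=
  inner ℝ (Avec (pt θ)) (tangent θ)

/-- The average `(2π)⁻¹ ∫₀^{2π} f(s) ds`. -/
def average (f : ℝ → ℝ) : ℝ := (1 / (2 * Real.pi)) * ∫ s in (0 : ℝ)..(2 * Real.pi), f s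

/-- The average `Ã` of the angular component of `Avec`. -/
def avgA (Avec : UnitCircle → Plane) : ℝ := average (angularComponent Avec)

/-- `ã`, the average of `a` over the circle. -/
def avga (a : UnitCircle → ℝ) : ℝ := average (fun θ => a (pt θ))

/-- The magnetic derivative `-i f' + A f`, in the angular variable. -/
def magneticDeriv (A : ℝ → ℝ) (f : ℝ → ℂ) (θ : ℝ) : ℂ :=
  -Complex.I * deriv f θ + (A θ : ℂ) * f θ

/-- `ψ` solves `(-i ∇_{𝕊¹} + Avec)² ψ + a ψ = μ ψ` on `𝕊¹`, where `Avec` is a tangential field. For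
Lipschitz `Avec` and `a`, every weak solution in `H¹(𝕊¹)` has `ψ` and `(-i ∇ + Avec) ψ` of class `C¹`,
so that the equation holds at every point. -/
def SolvesEigenEq (Avec : UnitCircle → Plane) (a : UnitCircle → ℝ) (μ : ℝ) (ψ : UnitCircle → ℂ) :
    Prop :=
  Differentiable ℝ (fun θ => ψ (pt θ)) ∧
  Differentiable ℝ (magneticDeriv (angularComponent Avec) (fun θ => ψ (pt θ))) ∧
  ∀ θ : ℝ,
    magneticDeriv (angularComponent Avec)
        (magneticDeriv (angularComponent Avec) (fun s => ψ (pt s))) θ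
      + (a (pt θ) : ℂ) * ψ (pt θ) = (μ : ℂ) * ψ (pt θ)

theorem magneticDeriv_add {A : ℝ → ℝ} {f g : ℝ → ℂ} (hf : Differentiable ℝ f)
    (hg : Differentiable ℝ g) :
    magneticDeriv A (fun θ => f θ + g θ)
      = fun θ => magneticDeriv A f θ + magneticDeriv A g θ := by
  funext θ
  simp only [magneticDeriv]
  rw [deriv_fun_add (hf θ) (hg θ)]
  ring

theorem magneticDeriv_mul {A : ℝ → ℝ} {f : ℝ → ℂ} (c : ℂ) (hf : Differentiable ℝ f) :
    magneticDeriv A (fun θ => c * f θ) = fun θ => c * magneticDeriv A f θ := by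
  funext θ
  simp only [magneticDeriv]
  rw [deriv_const_mul c (hf θ)]
  ring

/-- The eigenspace of `L_{Avec,a} = (-i ∇_{𝕊¹} + Avec)² + a` for the number `μ`
(zero when `μ` is not an eigenvalue). -/
def eigenspaceL (Avec : UnitCircle → Plane) (a : UnitCircle → ℝ) (μ : ℝ) :
    Submodule ℂ (UnitCircle → ℂ) where
  carrier := {ψ | SolvesEigenEq Avec a μ ψ}
  zero_mem' := by
    have h : magneticDeriv (angularComponent Avec) (fun _ : ℝ => (0 : ℂ)) = fun _ => 0 := by
      funext θ; simp [magneticDeriv]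
    refine ⟨by simp, ?_, ?_⟩
    · simp only [Pi.zero_apply, h]
      exact differentiable_const _
    · intro θ
      simp [h]
  add_mem' := by
    rintro f g ⟨hf, hf', ef⟩ ⟨hg, hg', eg⟩
    have h := magneticDeriv_add (A := angularComponent Avec) hf hg
    refine ⟨by simpa using hf.fun_add hg, ?_, ?_⟩
    · simp only [Pi.add_apply, h]
      exact hf'.fun_add hg'
    · intro θ
      simp only [Pi.add_apply, h]
      rw [magneticDeriv_add hf' hg']
      linear_combination ef θ + eg θ
  smul_mem' := by
    rintro c f ⟨hf, hf', ef⟩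
    have h := magneticDeriv_mul (A := angularComponent Avec) c hf
    refine ⟨by simpa using hf.const_mul c, ?_, ?_⟩
    · simp only [Pi.smul_apply, smul_eq_mul, h]
      exact hf'.const_mul c
    · intro θ
      simp only [Pi.smul_apply, smul_eq_mul, h]
      rw [magneticDeriv_mul c hf']
      linear_combination c * ef θ

/-- `ψ` is an `L²(𝕊¹)`-normalized eigenfunction of `L_{Avec,a}` for the eigenvalue `μ`. -/
def IsNormalizedEigenfunction (Avec : UnitCircle → Plane) (a : UnitCircle → ℝ) (μ : ℝ)
    (ψ : UnitCircle → ℂ) : Prop :=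
  ψ ∈ eigenspaceL Avec a μ ∧ ∫ θ in (0 : ℝ)..(2 * Real.pi), ‖ψ (pt θ)‖ ^ 2 = 1

/-- `μ 0 ≤ μ 1 ≤ μ 2 ≤ ⋯ → ∞` are the eigenvalues of `L_{Avec,a}`, each repeated according to its
finite multiplicity. The term `μ k` is the eigenvalue usually written `μ_{k+1}`. -/
structure IsEigenvalueSequence (Avec : UnitCircle → Plane) (a : UnitCircle → ℝ) (μ : ℕ → ℝ) :
    Prop where
  mono : Monotone μ
  tendsto : Tendsto μ atTop atTop
  finite : ∀ t : ℝ, Module.Finite ℂ (eigenspaceL Avec a t)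
  mult : ∀ t : ℝ, {k : ℕ | μ k = t}.ncard = Module.finrank ℂ (eigenspaceL Avec a t)

/-- The description of the large eigenvalues of `L_{Avec,a}`: up to finitely many of them (`kstar` in
number), the eigenvalues are the numbers `lam j`, `|j| ≥ ℓ`, each occurring once, with normalized
eigenfunctions `φ j` and remainders `R j`, and with the stated asymptotics as `|j| → ∞`. -/
structure IsHighSpectrum (Avec : UnitCircle → Plane) (a : UnitCircle → ℝ) (μ : ℕ → ℝ)
    (kstar ℓ : ℕ) (lam : ℤ → ℝ) (φ : ℤ → UnitCircle → ℂ) (R : ℤ → ℝ → ℂ) : Prop where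
  image_eq : μ '' {k | kstar ≤ k} = lam '' {j | (ℓ : ℤ) ≤ |j|}
  injOn_mu : Set.InjOn μ {k | kstar ≤ k}
  injOn_lam : Set.InjOn lam {j | (ℓ : ℤ) ≤ |j|}
  sqrt_asymp :
    (fun j : ℤ => √(lam j - avga a)
        - ((Int.sign j : ℝ) * (avgA Avec - (⌊avgA Avec + 1 / 2⌋ : ℝ)) + |(j : ℝ)|))
      =O[cofinite] fun j : ℤ => 1 / |(j : ℝ)| ^ 3
  asymp :
    (fun j : ℤ => lam j
        - (avga a + ((j : ℝ) + avgA Avec - (⌊avgA Avec + 1 / 2⌋ : ℝ)) ^ 2))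
      =O[cofinite] fun j : ℤ => 1 / (j : ℝ) ^ 2
  eigen : ∀ j : ℤ, (ℓ : ℤ) ≤ |j| → IsNormalizedEigenfunction Avec a (lam j) (φ j)
  eigen_eq : ∀ j : ℤ, (ℓ : ℤ) ≤ |j| → ∀ θ : ℝ,
    φ j (pt θ) = ((1 / √(2 * Real.pi) : ℝ) : ℂ)
      * Complex.exp (-Complex.I * (((⌊avgA Avec + 1 / 2⌋ : ℝ) * θ
          + ∫ t in (0 : ℝ)..θ, angularComponent Avec t : ℝ) : ℂ))
      * (Complex.exp (Complex.I * (((avgA Avec + j) * θ : ℝ) : ℂ)) + R j θ)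
  remainder : ∃ C : ℝ, ∀ᶠ j : ℤ in cofinite, ∀ θ : ℝ, ‖R j θ‖ ≤ C / |(j : ℝ)|

/-- The Bessel function of the first kind `J_ν(t)`, for `t ≥ 0`. -/
def besselJ (ν t : ℝ) : ℝ :=
  (t / 2) ^ ν * ∑' k : ℕ,
    (-1 : ℝ) ^ k / (Real.Gamma (k + 1) * Real.Gamma (k + ν + 1)) * (t / 2) ^ (2 * k)

/-- `α(μ) = -√μ` (dimension two). -/
def alphaExp (μ : ℝ) : ℝ := -√μ

/-- `β(μ) = √μ` (dimension two). -/
def betaExp (μ : ℝ) : ℝ := √μ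

/-- The factor `i^{-β(μ)} j_{-α(μ)}(t)`; in dimension two `j_ν = J_ν`. The power of `i` is
the principal one, `e^{-iπβ/2}`. -/
def radialFactor (μ t : ℝ) : ℂ :=
  Complex.I ^ (-(betaExp μ : ℂ)) * (besselJ (-alphaExp μ) t : ℂ)

/-- The direction `x / |x|` of a nonzero vector (an arbitrary point for `x = 0`). -/
def direction (x : Plane) : UnitCircle :=
  if h : x = 0 then pt 0 else ⟨‖x‖⁻¹ • x, by simp [norm_smul, h]⟩

/-- The `k`-th term of the series defining the kernel `K(x, y)`. -/
def kernelTerm (μ : ℕ → ℝ) (ψ : ℕ → UnitCircle → ℂ) (x y : Plane) (k : ℕ) : ℂ :=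
  radialFactor (μ k) (‖x‖ * ‖y‖) * ψ k (direction x) * conj (ψ k (direction y))

/-- The kernel `K(x, y) = ∑_k i^{-β_k} j_{-α_k}(|x||y|) ψ_k(x/|x|) conj ψ_k(y/|y|)`. -/
def kernelK (μ : ℕ → ℝ) (ψ : ℕ → UnitCircle → ℂ) (x y : Plane) : ℂ :=
  ∑' k : ℕ, kernelTerm μ ψ x y k

/-- The `j`-th term of the series over the large eigenvalues, without the gauge factor:
`i^{-β(λ_j)} j_{-α(λ_j)}(r r') (e^{i(Ã+j)θ} + R_j(θ)) (e^{-i(Ã+j)θ'} + conj R_j(θ'))`. -/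
def highTerm (Avec : UnitCircle → Plane) (lam : ℤ → ℝ) (R : ℤ → ℝ → ℂ)
    (r r' θ θ' : ℝ) (j : ℤ) : ℂ :=
  radialFactor (lam j) (r * r')
    * (Complex.exp (Complex.I * (((avgA Avec + j) * θ : ℝ) : ℂ)) + R j θ)
    * (Complex.exp (-Complex.I * (((avgA Avec + j) * θ' : ℝ) : ℂ)) + conj (R j θ'))

end

/-! Put `δ = Ã - ⌊Ã + 1/2⌋`. Multiplication by the phase `exp (-i (∫₀^θ A - δ θ))`, which is
`2π`-periodic because `Ã - δ` is an integer, turns the field into the constant `δ`. The operator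
becomes `(-i d/dθ + δ)² + q` on `ℝ / 2πℤ`, whose unperturbed part is diagonal in the Fourier basis
with entries `(n + δ)²`.

Since `2δ` stays away from the integers, the factorization `(j + δ)² - (n + δ)² = (j - n)(j + n +
2δ)` separates `(j + δ)²` from all other entries by a multiple of `|j|` (`IsNonresonant.gap`). The
reduced resolvent at `(j + δ)²` is therefore `O(1/|j|)` even in the sup norm, and a contraction
produces an eigenfunction `fourier j + h` with `h = O(1/|j|)`
(`exists_fixedPoint_reducedResolvent`). The mean of `q` is the first order shift of the eigenvalue.
The second order shift is `O(j⁻²)` and not merely `O(1/|j|)`, because the frequencies `j + m` and `j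
- m` nearly cancel and `q`, being Lipschitz, has coefficients `O(1/|m|)`
(`exists_perturbed_eigenpair`).

These are all the large eigenvalues: each eigenvalue lies within `‖q‖` of some `(n + δ)²`, and a
second one near `(j + δ)²` would have an eigenfunction orthogonal to `fourier j + h`, which a mass
estimate excludes (`exists_large_eigenvalues`). Simplicity follows from a Wronskian, and a Bessel
inequality count shows that only finitely many eigenvalues lie below any bound, so they can be
enumerated.

For the kernel, `J_ν(t)` decays faster than any geometric sequence as `ν → ∞`, while `√λ_j` grows
like `|j|`. The series converge absolutely, the large eigenvalues may be re-indexed by `j`, and the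
product of the two explicit eigenfunctions yields the phase factors (`IsHighSpectrum.kernelK_eq`).
-/

noncomputable section

/-! ### Fourier coefficients of continuous functions on the circle -/

instance two_pi_pos_fact : Fact (0 < 2 * Real.pi) := ⟨Real.two_pi_pos⟩

/-- The circle `ℝ / 2πℤ`. -/
abbrev Circ : Type := AddCircle (2 * Real.pi)

/-- The class in `L²(ℝ / 2πℤ)` of a continuous function. -/
def circleL2 : C(Circ, ℂ) →L[ℂ] MeasureTheory.Lp ℂ 2 (AddCircle.haarAddCircle (T := 2 * Real.pi)) :=
  ContinuousMap.toLp (E := ℂ) 2 AddCircle.haarAddCircle ℂ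

/-- The `n`-th Fourier coefficient as a continuous linear functional. -/
def circleCoeff (n : ℤ) : C(Circ, ℂ) →L[ℂ] ℂ :=
  (innerSL ℂ (fourierLp (T := 2 * Real.pi) 2 n)).comp circleL2

theorem circleCoeff_eq_repr (n : ℤ) (v : C(Circ, ℂ)) :
    circleCoeff n v = fourierBasis.repr (circleL2 v) n := by
  rw [HilbertBasis.repr_apply_apply, coe_fourierBasis]
  simp [circleCoeff]

theorem circleCoeff_eq_fourierCoeff (n : ℤ) (v : C(Circ, ℂ)) :
    circleCoeff n v = fourierCoeff v n := by
  rw [circleCoeff_eq_repr, fourierBasis_repr]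
  exact fourierCoeff_toLp v n

theorem circleCoeff_fourier (n m : ℤ) :
    circleCoeff n (fourier m : C(Circ, ℂ)) = if n = m then 1 else 0 := by
  rw [circleCoeff_eq_fourierCoeff, fourierCoeff_fourier, Pi.single_apply]

theorem circleL2_injective : Function.Injective circleL2 :=
  ContinuousMap.toLp_injective AddCircle.haarAddCircle

theorem eq_of_circleCoeff_eq {v w : C(Circ, ℂ)} (h : ∀ n, circleCoeff n v = circleCoeff n w) :
    v = w := by
  apply circleL2_injective
  apply fourierBasis.repr.injective
  ext n
  rw [← circleCoeff_eq_repr, ← circleCoeff_eq_repr, h]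

theorem hasSum_inner_circleCoeff (v w : C(Circ, ℂ)) :
    HasSum (fun n => conj (circleCoeff n v) * circleCoeff n w)
      (inner ℂ (circleL2 v) (circleL2 w)) := by
  have h := fourierBasis.hasSum_inner_mul_inner (circleL2 v) (circleL2 w)
  refine h.congr_fun ?_
  intro n
  rw [circleCoeff_eq_repr, circleCoeff_eq_repr, HilbertBasis.repr_apply_apply,
    HilbertBasis.repr_apply_apply, inner_conj_symm]

theorem hasSum_norm_sq_circleCoeff (v : C(Circ, ℂ)) :
    HasSum (fun n => ‖circleCoeff n v‖ ^ 2) (‖circleL2 v‖ ^ 2) := by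
  have h := hasSum_inner_circleCoeff v v
  rw [inner_self_eq_norm_sq_to_K] at h
  simp only [Complex.conj_mul'] at h
  apply Complex.hasSum_ofReal.mp
  simpa using h

/-- The Haar measure has total mass one, so the sup norm dominates the `L²` norm with constant one.
-/
theorem norm_circleL2_le (v : C(Circ, ℂ)) : ‖circleL2 v‖ ≤ ‖v‖ := by
  have h := ContinuousMap.toLp_norm_le (E := ℂ) (p := 2) (𝕜 := ℂ)
    (μ := AddCircle.haarAddCircle (T := 2 * Real.pi))
  have h2 := (circleL2).le_opNorm v
  have : ‖circleL2‖ ≤ 1 := by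
    refine h.trans ?_
    simp [MeasureTheory.measureUnivNNReal]
  nlinarith [norm_nonneg v]

theorem inner_circleL2 (v w : C(Circ, ℂ)) : inner ℂ (circleL2 v) (circleL2 w)
    = ∫ x, w x * conj (v x) ∂(AddCircle.haarAddCircle (T := 2 * Real.pi)) :=
  MeasureTheory.ContinuousMap.inner_toLp AddCircle.haarAddCircle v w

theorem inner_circleL2_mul (q v w : C(Circ, ℂ)) :
    inner ℂ (circleL2 (q * v)) (circleL2 w) = inner ℂ (circleL2 v) (circleL2 (star q * w)) := by
  rw [inner_circleL2, inner_circleL2]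
  congr 1
  ext x
  simp
  ring

theorem norm_sq_circleL2 (v : C(Circ, ℂ)) : ‖circleL2 v‖ ^ 2
    = ∫ x, ‖v x‖ ^ 2 ∂(AddCircle.haarAddCircle (T := 2 * Real.pi)) := by
  have h := inner_circleL2 v v
  rw [inner_self_eq_norm_sq_to_K] at h
  simp only [Complex.mul_conj'] at h
  have h2 : ∫ x, ((‖v x‖ : ℂ)) ^ 2 ∂(AddCircle.haarAddCircle (T := 2 * Real.pi))
    = ((∫ x, ‖v x‖ ^ 2 ∂(AddCircle.haarAddCircle (T := 2 * Real.pi)) : ℝ) : ℂ) := by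
    rw [← integral_complex_ofReal]
    simp
  rw [h2] at h
  apply Complex.ofReal_injective
  simpa using h

theorem ContinuousMap.integrable_circle {E : Type*} [NormedAddCommGroup E] (v : C(Circ, E)) :
    MeasureTheory.Integrable v (AddCircle.haarAddCircle (T := 2 * Real.pi)) :=
  v.continuous.integrable_of_hasCompactSupport (HasCompactSupport.of_compactSpace v)

theorem norm_circleL2_mul_le (q v : C(Circ, ℂ)) :
    ‖circleL2 (q * v)‖ ≤ ‖q‖ * ‖circleL2 v‖ := by
  have hc : ‖circleL2 (q * v)‖ ^ 2 ≤ (‖q‖ * ‖circleL2 v‖) ^ 2 := by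
    rw [mul_pow, norm_sq_circleL2, norm_sq_circleL2, ← MeasureTheory.integral_const_mul]
    have i1 := ContinuousMap.integrable_circle (E := ℝ)
      ⟨fun x => ‖(q * v) x‖ ^ 2, (q * v).continuous.norm.pow 2⟩
    have i2 := ContinuousMap.integrable_circle (E := ℝ)
      ⟨fun x => ‖v x‖ ^ 2, v.continuous.norm.pow 2⟩
    refine MeasureTheory.integral_mono i1 (i2.const_mul (‖q‖ ^ 2)) ?_
    intro x
    have h1 : ‖(q * v) x‖ ^ 2 = ‖q x‖ ^ 2 * ‖v x‖ ^ 2 := by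
      rw [ContinuousMap.mul_apply, norm_mul, mul_pow]
    have h2 : ‖q x‖ ^ 2 ≤ ‖q‖ ^ 2 := pow_le_pow_left₀ (norm_nonneg _) (q.norm_coe_le_norm x) 2
    exact h1.trans_le (mul_le_mul_of_nonneg_right h2 (sq_nonneg _))
  exact (sq_le_sq₀ (norm_nonneg _) (mul_nonneg (norm_nonneg _) (norm_nonneg _))).mp hc

theorem circleL2_ne_zero {v : C(Circ, ℂ)} (h : v ≠ 0) : circleL2 v ≠ 0 := by
  intro h0
  exact h (circleL2_injective (by rw [h0, map_zero]))

/-- A Fourier coefficient of a product with `fourier j`. -/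
theorem circleCoeff_mul_fourier (p : C(Circ, ℂ)) (n j : ℤ) :
    circleCoeff n (p * fourier j) = circleCoeff (n - j) p := by
  rw [circleCoeff_eq_fourierCoeff, circleCoeff_eq_fourierCoeff]
  unfold fourierCoeff
  congr 1
  ext x
  have : (-(n - j)) = -n + j := by ring
  rw [this, fourier_add]
  simp only [ContinuousMap.mul_apply, smul_eq_mul]
  ring

theorem circleCoeff_star (p : C(Circ, ℂ)) (n : ℤ) :
    circleCoeff n (star p) = conj (circleCoeff (-n) p) := by
  rw [circleCoeff_eq_fourierCoeff, circleCoeff_eq_fourierCoeff]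
  unfold fourierCoeff
  rw [← integral_conj]
  congr 1
  ext x
  simp [-fourier_apply, fourier_neg]

theorem norm_circleCoeff_le (v : C(Circ, ℂ)) (n : ℤ) : ‖circleCoeff n v‖ ≤ ‖circleL2 v‖ := by
  refine abs_le_of_sq_le_sq' ?_ (by positivity) |>.2
  exact le_hasSum (hasSum_norm_sq_circleCoeff v) n (fun _ _ => by positivity)

theorem circleL2_fourier_norm (j : ℤ) : ‖circleL2 (fourier j : C(Circ, ℂ))‖ = 1 :=
  (orthonormal_fourier (T := 2 * Real.pi)).1 j

/-- Fourier coefficients of Lipschitz functions are `O(1/|m|)`. -/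
theorem norm_circleCoeff_mul_le_of_lipschitz {p : C(Circ, ℂ)} {L : ℝ}
    (hL : ∀ s t : ℝ, ‖p (s : Circ) - p (t : Circ)‖ ≤ L * |s - t|) (m : ℤ) :
    |(m : ℝ)| * ‖circleCoeff m p‖ ≤ L * Real.pi := by
  have hL0 : 0 ≤ L := by
    have := (norm_nonneg _).trans (hL 1 0)
    simpa using this
  rcases eq_or_ne m 0 with rfl | hm
  · simp; positivity
  have hm' : (m : ℝ) ≠ 0 := by exact_mod_cast hm
  -- Translation by the half period `π / m` changes the sign of `fourier (-m)`. Averaging the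
  -- integral with its translate leaves a difference of `p` at distance `|s|`, which the Lipschitz
  -- bound controls without any derivative.
  set s : ℝ := Real.pi / m with hs
  set F : Circ → ℂ := fun x => fourier (-m) x * p x with hF
  have e1 : circleCoeff m p = ∫ x, F x ∂(AddCircle.haarAddCircle (T := 2 * Real.pi)) := by
    rw [circleCoeff_eq_fourierCoeff]; rfl
  have e2 : circleCoeff m p
      = ∫ x, F (x + (s : Circ)) ∂(AddCircle.haarAddCircle (T := 2 * Real.pi)) := by
    rw [e1]; exact (MeasureTheory.integral_add_right_eq_self F (s : Circ)).symm
  have hshift : ∀ x : Circ, fourier (-m) (x + (s : Circ)) = -fourier (-m) x := by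
    intro x
    have := fourier_add_half_inv_index (T := 2 * Real.pi) (n := -m) (by simpa using hm)
      Real.two_pi_pos (x + (s : Circ))
    have hs' : x + (s : Circ) + ((2 * Real.pi / 2 / ((-m : ℤ) : ℝ) : ℝ) : Circ) = x := by
      rw [add_assoc, ← AddCircle.coe_add]
      have : s + 2 * Real.pi / 2 / ((-m : ℤ) : ℝ) = 0 := by
        rw [hs]; push_cast; field_simp; ring
      rw [this]; simp
    rw [hs'] at this
    rw [this, neg_neg]
  have e3 : 2 * circleCoeff m p
      = ∫ x, fourier (-m) x * (p x - p (x + (s : Circ)))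
          ∂(AddCircle.haarAddCircle (T := 2 * Real.pi)) := by
    rw [two_mul]
    nth_rw 1 [e1]
    rw [e2, ← MeasureTheory.integral_add]
    · congr 1
      ext x
      simp only [hF, hshift]
      ring
    · exact ContinuousMap.integrable_circle ⟨F, by fun_prop⟩
    · exact ContinuousMap.integrable_circle ⟨fun x => F (x + (s : Circ)), by fun_prop⟩
  have e4 : ‖2 * circleCoeff m p‖ ≤ L * |s| := by
    rw [e3]
    refine (MeasureTheory.norm_integral_le_of_norm_le_const (C := L * |s|) ?_).trans ?_
    · refine Eventually.of_forall fun x => ?_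
      induction x using QuotientAddGroup.induction_on with
      | H x =>
        have h1 : ‖fourier (-m) (x : Circ)‖ = 1 := by
          rw [fourier_apply, Circle.norm_coe]
        rw [norm_mul]
        have h2 := hL x (x + s)
        have h3 : ((x + s : ℝ) : Circ) = (x : Circ) + (s : Circ) := rfl
        rw [h3] at h2
        have h4 : |x - (x + s)| = |s| := by rw [← abs_neg]; congr 1; ring
        rw [h4] at h2
        erw [h1, one_mul]
        exact h2
    · simp
  rw [norm_mul, hs, abs_div, abs_of_pos Real.pi_pos] at e4
  have hmpos : 0 < |(m : ℝ)| := abs_pos.mpr hm'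
  have : |(m : ℝ)| * (L * (Real.pi / |(m : ℝ)|)) = L * Real.pi := by field_simp
  have h5 : |(m : ℝ)| * (‖(2 : ℂ)‖ * ‖circleCoeff m p‖) ≤ L * Real.pi := by
    rw [← this]; gcongr
  simp at h5
  nlinarith [norm_nonneg (circleCoeff m p), mul_nonneg hmpos.le (norm_nonneg (circleCoeff m p))]

/-! ### Nonresonance and the reduced resolvent -/

/-- Cauchy–Schwarz for infinite sums. -/
theorem summable_mul_and_tsum_le_of_sq {ι : Type*} {f g : ι → ℝ} {A B : ℝ} (hA : 0 ≤ A)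
    (hB : 0 ≤ B) (hf0 : ∀ i, 0 ≤ f i) (hg0 : ∀ i, 0 ≤ g i)
    (hf : Summable fun i => f i ^ 2) (hg : Summable fun i => g i ^ 2)
    (hfA : ∑' i, f i ^ 2 ≤ A ^ 2) (hgB : ∑' i, g i ^ 2 ≤ B ^ 2) :
    Summable (fun i => f i * g i) ∧ ∑' i, f i * g i ≤ A * B := by
  have key : ∀ s : Finset ι, ∑ i ∈ s, f i * g i ≤ A * B := by
    intro s
    have h1 := Finset.sum_mul_sq_le_sq_mul_sq s f g
    have h2 : ∑ i ∈ s, f i ^ 2 ≤ A ^ 2 :=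
      (hf.sum_le_tsum s fun i _ => sq_nonneg _).trans hfA
    have h3 : ∑ i ∈ s, g i ^ 2 ≤ B ^ 2 :=
      (hg.sum_le_tsum s fun i _ => sq_nonneg _).trans hgB
    have h4 : (∑ i ∈ s, f i * g i) ^ 2 ≤ (A * B) ^ 2 := by
      rw [mul_pow]
      exact h1.trans (mul_le_mul h2 h3 (Finset.sum_nonneg fun i _ => sq_nonneg _) (sq_nonneg _))
    exact (abs_le_of_sq_le_sq' h4 (mul_nonneg hA hB)).2
  have hs : Summable (fun i => f i * g i) :=
    summable_of_sum_le (fun i => mul_nonneg (hf0 i) (hg0 i)) key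
  exact ⟨hs, hs.tsum_le_of_sum_le key⟩

/-- The Fourier multiplier of the reduced resolvent of `(-i d/dθ + δ)²` at `(j + δ)²`; the value at
`n = j` is zero. -/
def resolventCoeff (δ : ℝ) (j n : ℤ) : ℝ := (((j : ℝ) + δ) ^ 2 - ((n : ℝ) + δ) ^ 2)⁻¹

theorem resolventCoeff_self (δ : ℝ) (j : ℤ) : resolventCoeff δ j j = 0 := by
  simp [resolventCoeff]

/-- `δ` is reduced modulo the integers, and `2 * δ` is at distance at least `κ` from them. -/
structure IsNonresonant (δ κ : ℝ) : Prop where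
  pos : 0 < κ
  le_one : κ ≤ 1
  abs_le : |δ| ≤ 1 / 2
  le_abs : ∀ m : ℤ, κ ≤ |2 * δ + m|

theorem exists_isNonresonant {δ : ℝ} (h1 : |δ| ≤ 1 / 2) (h2 : ∀ m : ℤ, 2 * δ ≠ m) :
    ∃ κ, IsNonresonant δ κ := by
  have hpos : 0 < |2 * δ - round (2 * δ)| := abs_pos.mpr (sub_ne_zero.mpr (h2 _))
  refine ⟨min 1 |2 * δ - round (2 * δ)|, lt_min one_pos hpos, min_le_left _ _, h1, fun m => ?_⟩
  refine (min_le_right _ _).trans ?_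
  have := round_le (2 * δ) (-m)
  simpa using this

theorem sq_shift_sub_sq_shift (δ : ℝ) (j n : ℤ) : ((j : ℝ) + δ) ^ 2 - ((n : ℝ) + δ) ^ 2
    = ((j : ℝ) - n) * ((n : ℝ) + j + 2 * δ) := by ring

theorem one_le_abs_cast_sub {j n : ℤ} (hn : n ≠ j) : 1 ≤ |(j : ℝ) - n| := by
  have : (1 : ℤ) ≤ |j - n| := Int.one_le_abs (sub_ne_zero.mpr hn.symm)
  exact_mod_cast this

namespace IsNonresonant

variable {δ κ : ℝ} (hδ : IsNonresonant δ κ)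
include hδ

theorem le_abs_add (j n : ℤ) : κ ≤ |(n : ℝ) + j + 2 * δ| := by
  have := hδ.le_abs (n + j)
  push_cast at this
  rwa [add_comm]

/-- The two factors of `(j + δ)² - (n + δ)²` add up to `2j + 2δ`, and `|2δ| ≤ 1 ≤ |j|`. -/
theorem abs_le_add {j : ℤ} (hj : j ≠ 0) (n : ℤ) :
    |(j : ℝ)| ≤ |(j : ℝ) - n| + |(n : ℝ) + j + 2 * δ| := by
  have h1 : (1 : ℝ) ≤ |(j : ℝ)| := by exact_mod_cast Int.one_le_abs hj
  have h2 := abs_add_le ((j : ℝ) - n) ((n : ℝ) + j + 2 * δ)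
  have h3 : ((j : ℝ) - n) + ((n : ℝ) + j + 2 * δ) = 2 * j - (-(2 * δ)) := by ring
  have h4 := abs_sub_abs_le_abs_sub (2 * (j : ℝ)) (-(2 * δ))
  rw [h3] at h2
  rw [abs_neg, abs_mul, abs_mul, abs_two] at h4
  linarith [hδ.abs_le]

/-- By `abs_le_add` one of the two factors is at least `|j| / 2`; the other is at least `1` or at
least `κ`. -/
theorem gap {j n : ℤ} (hj : j ≠ 0) (hn : n ≠ j) :
    κ / 2 * |(j : ℝ)| ≤ |((j : ℝ) + δ) ^ 2 - ((n : ℝ) + δ) ^ 2| := by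
  rw [sq_shift_sub_sq_shift, abs_mul]
  have h1 := one_le_abs_cast_sub hn
  have h2 := hδ.le_abs_add j n
  have h3 := hδ.abs_le_add hj n
  have h4 := hδ.pos
  have h5 := hδ.le_one
  rcases le_total (|(j : ℝ)| / 2) |(j : ℝ) - n| with h | h
  · nlinarith [abs_nonneg (j : ℝ)]
  · have h6 : |(j : ℝ)| / 2 ≤ |(n : ℝ) + j + 2 * δ| := by linarith
    nlinarith [abs_nonneg (j : ℝ)]

theorem abs_resolventCoeff_le {j : ℤ} (hj : j ≠ 0) (n : ℤ) :
    |resolventCoeff δ j n| ≤ 2 / κ / |(j : ℝ)| := by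
  have hκ := hδ.pos
  have hj1 : (0 : ℝ) < |(j : ℝ)| := abs_pos.mpr (by exact_mod_cast hj)
  rcases eq_or_ne n j with rfl | hn
  · rw [resolventCoeff_self, abs_zero]; positivity
  · rw [resolventCoeff, abs_inv]
    have := hδ.gap hj hn
    have h0 : 0 < κ / 2 * |(j : ℝ)| := by positivity
    calc _ ≤ (κ / 2 * |(j : ℝ)|)⁻¹ := inv_anti₀ h0 this
      _ = _ := by field_simp

/-- With `a`, `b` the moduli of the two factors and `c = |j| ≤ a + b`, one has `c² ≤ 2(a² + b²)`;
dividing by `a² b² c²` splits the square of the multiplier into two translates of summable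
sequences. -/
theorem sq_resolventCoeff_le {j : ℤ} (hj : j ≠ 0) (n : ℤ) :
    resolventCoeff δ j n ^ 2
      ≤ 2 / |(j : ℝ)| ^ 2 * ((((n - j : ℤ) : ℝ) ^ 2)⁻¹ + ((((n + j : ℤ) : ℝ) + 2 * δ) ^ 2)⁻¹) := by
  have hκ := hδ.pos
  have hj1 : (0 : ℝ) < |(j : ℝ)| := abs_pos.mpr (by exact_mod_cast hj)
  rcases eq_or_ne n j with rfl | hn
  · rw [resolventCoeff_self, zero_pow two_ne_zero]; positivity
  have h1 := one_le_abs_cast_sub hn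
  have h2 := hδ.le_abs_add j n
  have h3 := hδ.abs_le_add hj n
  push_cast
  rw [resolventCoeff, sq_shift_sub_sq_shift, ← sq_abs ((n : ℝ) - j), ← sq_abs ((n : ℝ) + j + 2 * δ),
    abs_sub_comm (n : ℝ) j, inv_pow, mul_pow, ← sq_abs ((j : ℝ) - n),
    ← sq_abs ((n : ℝ) + j + 2 * δ)]
  set a := |(j : ℝ) - n|
  set b := |(n : ℝ) + j + 2 * δ|
  set c := |(j : ℝ)|
  have ha : 0 < a := by linarith
  have hb : 0 < b := by linarith
  have e : 2 / c ^ 2 * ((a ^ 2)⁻¹ + (b ^ 2)⁻¹) = 2 * (a ^ 2 + b ^ 2) / c ^ 2 * (a ^ 2 * b ^ 2)⁻¹ := by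
    field_simp
    ring
  rw [e]
  refine le_mul_of_one_le_left (by positivity) ?_
  rw [one_le_div (by positivity)]
  nlinarith [sq_nonneg (a - b)]

theorem exists_tsum_sq_resolventCoeff_le : ∃ C : ℝ, 0 < C ∧ ∀ j : ℤ, j ≠ 0 →
    Summable (fun n => resolventCoeff δ j n ^ 2) ∧
      ∑' n, resolventCoeff δ j n ^ 2 ≤ (C / |(j : ℝ)|) ^ 2 := by
  have s : ∀ a : ℝ, Summable (fun n : ℤ => (((n : ℝ) + a) ^ 2)⁻¹) := by
    intro a
    have := (Real.summable_one_div_int_add_rpow a 2).mpr (by norm_num)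
    refine this.congr fun n => ?_
    rw [one_div, Real.rpow_two, sq_abs]
  have s0 : Summable (fun n : ℤ => ((n : ℝ) ^ 2)⁻¹) := by simpa using s 0
  set S1 := ∑' n : ℤ, ((n : ℝ) ^ 2)⁻¹
  set S2 := ∑' n : ℤ, (((n : ℝ) + 2 * δ) ^ 2)⁻¹
  have hS1 : 0 ≤ S1 := tsum_nonneg fun n => by positivity
  have hS2 : 0 ≤ S2 := tsum_nonneg fun n => by positivity
  -- `S1` and `S2` do not depend on `j`, by translation of the index. The summand `1` only makes the
  -- constant positive.
  refine ⟨√(2 * (S1 + S2) + 1), by positivity, fun j hj => ?_⟩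
  have hj1 : (0 : ℝ) < |(j : ℝ)| := abs_pos.mpr (by exact_mod_cast hj)
  have t1 : HasSum (fun n : ℤ => (((n - j : ℤ) : ℝ) ^ 2)⁻¹) S1 :=
    ((Equiv.subRight j).hasSum_iff (f := fun n : ℤ => ((n : ℝ) ^ 2)⁻¹)).mpr s0.hasSum
  have t2 : HasSum (fun n : ℤ => ((((n + j : ℤ) : ℝ) + 2 * δ) ^ 2)⁻¹) S2 :=
    ((Equiv.addRight j).hasSum_iff (f := fun n : ℤ => (((n : ℝ) + 2 * δ) ^ 2)⁻¹)).mpr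
      (s (2 * δ)).hasSum
  have t := (t1.add t2).mul_left (2 / |(j : ℝ)| ^ 2)
  have hs : Summable (fun n => resolventCoeff δ j n ^ 2) :=
    Summable.of_nonneg_of_le (fun n => sq_nonneg _) (hδ.sq_resolventCoeff_le hj) t.summable
  refine ⟨hs, (hs.tsum_le_tsum (hδ.sq_resolventCoeff_le hj) t.summable).trans ?_⟩
  rw [t.tsum_eq, div_pow, Real.sq_sqrt (by positivity), div_mul_eq_mul_div]
  gcongr
  linarith

end IsNonresonant

/-- The reduced resolvent of `(-i d/dθ + δ)²` at `(j + δ)²`. -/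
def reducedResolvent (δ : ℝ) (j : ℤ) (u : C(Circ, ℂ)) : C(Circ, ℂ) :=
  ∑' n : ℤ, ((resolventCoeff δ j n : ℂ) * circleCoeff n u) • (fourier n : C(Circ, ℂ))

section

variable {δ K : ℝ} {j : ℤ} (hK : 0 ≤ K) (hs : Summable (fun n => resolventCoeff δ j n ^ 2))
  (hsK : ∑' n, resolventCoeff δ j n ^ 2 ≤ K ^ 2)
include hK hs hsK

/-- Square summability of the multiplier puts the image of `L²` among absolutely convergent Fourier
series. This is what makes sup norm estimates possible. -/
theorem summable_resolventCoeff_mul (u : C(Circ, ℂ)) :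
    Summable (fun n => |resolventCoeff δ j n| * ‖circleCoeff n u‖) ∧
      ∑' n, |resolventCoeff δ j n| * ‖circleCoeff n u‖ ≤ K * ‖circleL2 u‖ := by
  have h := hasSum_norm_sq_circleCoeff u
  exact summable_mul_and_tsum_le_of_sq hK (norm_nonneg _) (fun _ => abs_nonneg _)
    (fun _ => norm_nonneg _) (by simpa using hs) h.summable (by simpa using hsK) h.tsum_eq.le

theorem hasSum_reducedResolvent (u : C(Circ, ℂ)) :
    HasSum (fun n : ℤ => ((resolventCoeff δ j n : ℂ) * circleCoeff n u) • (fourier n : C(Circ, ℂ)))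
      (reducedResolvent δ j u) := by
  refine Summable.hasSum (Summable.of_norm ?_)
  refine (summable_resolventCoeff_mul hK hs hsK u).1.congr fun n => ?_
  rw [norm_smul, fourier_norm, mul_one, norm_mul, Complex.norm_real, Real.norm_eq_abs]

theorem norm_reducedResolvent_le (u : C(Circ, ℂ)) :
    ‖reducedResolvent δ j u‖ ≤ K * ‖u‖ := by
  have h := summable_resolventCoeff_mul hK hs hsK u
  have h2 : ‖reducedResolvent δ j u‖ ≤ ∑' n, |resolventCoeff δ j n| * ‖circleCoeff n u‖ := by
    refine tsum_of_norm_bounded h.1.hasSum fun n => ?_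
    rw [norm_smul, fourier_norm, mul_one, norm_mul, Complex.norm_real, Real.norm_eq_abs]
  exact h2.trans (h.2.trans (mul_le_mul_of_nonneg_left (norm_circleL2_le u) hK))

theorem circleCoeff_reducedResolvent (u : C(Circ, ℂ)) (n : ℤ) :
    circleCoeff n (reducedResolvent δ j u) = (resolventCoeff δ j n : ℂ) * circleCoeff n u := by
  have h := (circleCoeff n).hasSum (hasSum_reducedResolvent hK hs hsK u)
  refine h.unique ?_
  have h2 := hasSum_ite_eq n ((resolventCoeff δ j n : ℂ) * circleCoeff n u)
  refine h2.congr_fun ?_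
  intro m
  simp only [map_smul, circleCoeff_fourier, smul_eq_mul]
  by_cases hm : m = n
  · subst hm; simp
  · simp [hm, Ne.symm hm]

theorem reducedResolvent_sub (u w : C(Circ, ℂ)) :
    reducedResolvent δ j (u - w) = reducedResolvent δ j u - reducedResolvent δ j w := by
  apply eq_of_circleCoeff_eq
  intro n
  rw [map_sub]
  simp only [circleCoeff_reducedResolvent hK hs hsK, map_sub]
  ring

/-- Lyapunov–Schmidt reduction. Seek an eigenfunction `fourier j + h` with `h` free of frequency
`j`, for a potential `p` of mean zero. The equation at frequency `j` fixes the eigenvalue shift as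
`circleCoeff j (p * h)`; the equations at the other frequencies are the fixed point equation. The
map is quadratic in `h`, and on the unit ball its Lipschitz constant is at most `3 * K * ‖p‖`,
whence the condition with the factor `6`. -/
theorem exists_fixedPoint_reducedResolvent (p : C(Circ, ℂ)) (hp : 6 * K * ‖p‖ ≤ 1) :
    ∃ h : C(Circ, ℂ), ‖h‖ ≤ 3 * K * ‖p‖ ∧ ∀ n, circleCoeff n h = (resolventCoeff δ j n : ℂ) *
      circleCoeff n (p * fourier j + p * h - circleCoeff j (p * h) • h) := by
  set Φ : C(Circ, ℂ) → C(Circ, ℂ) := fun h =>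
    reducedResolvent δ j (p * fourier j + p * h - circleCoeff j (p * h) • h) with hΦ
  have hM := norm_nonneg p
  have hc : ∀ w : C(Circ, ℂ), ‖circleCoeff j (p * w)‖ ≤ ‖p‖ * ‖w‖ := fun w =>
    (norm_circleCoeff_le _ _).trans ((norm_circleL2_le _).trans (norm_mul_le _ _))
  have hbound : ∀ h : C(Circ, ℂ), ‖h‖ ≤ 1 → ‖Φ h‖ ≤ 3 * K * ‖p‖ := by
    intro h hh
    refine (norm_reducedResolvent_le hK hs hsK _).trans ?_
    have e1 : ‖p * fourier j‖ ≤ ‖p‖ := (norm_mul_le _ _).trans (by rw [fourier_norm, mul_one])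
    have e2 : ‖p * h‖ ≤ ‖p‖ := (norm_mul_le _ _).trans (mul_le_of_le_one_right hM hh)
    have e3 : ‖circleCoeff j (p * h) • h‖ ≤ ‖p‖ := by
      rw [norm_smul]
      have := (hc h).trans (mul_le_of_le_one_right hM hh)
      exact (mul_le_of_le_one_right (norm_nonneg _) hh).trans this
    have e4 := norm_sub_le (p * fourier j + p * h) (circleCoeff j (p * h) • h)
    have e5 := norm_add_le (p * fourier j) (p * h)
    have : ‖p * fourier j + p * h - circleCoeff j (p * h) • h‖ ≤ 3 * ‖p‖ := by linarith
    nlinarith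
  have hlip : ∀ h h' : C(Circ, ℂ), ‖h‖ ≤ 1 → ‖h'‖ ≤ 1 → ‖Φ h - Φ h'‖ ≤ 1 / 2 * ‖h - h'‖ := by
    intro h h' hh hh'
    simp only [hΦ]
    rw [← reducedResolvent_sub hK hs hsK]
    refine (norm_reducedResolvent_le hK hs hsK _).trans ?_
    -- The quadratic term is split so that each of the three pieces is linear in `h - h'`.
    have e : p * fourier j + p * h - circleCoeff j (p * h) • h
        - (p * fourier j + p * h' - circleCoeff j (p * h') • h')
        = p * (h - h') - (circleCoeff j (p * (h - h')) • h + circleCoeff j (p * h') • (h - h')) := by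
      rw [mul_sub, map_sub, sub_smul, smul_sub]
      abel
    rw [e]
    set d := ‖h - h'‖
    have e1 : ‖p * (h - h')‖ ≤ ‖p‖ * d := norm_mul_le _ _
    have e2 : ‖circleCoeff j (p * (h - h')) • h‖ ≤ ‖p‖ * d := by
      rw [norm_smul]
      exact (mul_le_of_le_one_right (norm_nonneg _) hh).trans (hc _)
    have e3 : ‖circleCoeff j (p * h') • (h - h')‖ ≤ ‖p‖ * d := by
      rw [norm_smul]
      have := (hc h').trans (mul_le_of_le_one_right hM hh')
      exact mul_le_mul_of_nonneg_right this (norm_nonneg _)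
    have e4 := norm_sub_le (p * (h - h'))
      (circleCoeff j (p * (h - h')) • h + circleCoeff j (p * h') • (h - h'))
    have e5 := norm_add_le (circleCoeff j (p * (h - h')) • h) (circleCoeff j (p * h') • (h - h'))
    have e6 : ‖p * (h - h') - (circleCoeff j (p * (h - h')) • h + circleCoeff j (p * h') • (h - h'))‖
      ≤ 3 * ‖p‖ * d := by linarith
    have hd : 0 ≤ d := norm_nonneg _
    calc _ ≤ K * (3 * ‖p‖ * d) := mul_le_mul_of_nonneg_left e6 hK
      _ = (6 * K * ‖p‖) * (1 / 2 * d) := by ring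
      _ ≤ 1 * (1 / 2 * d) := by gcongr
      _ = _ := one_mul _
  have hmaps : Set.MapsTo Φ (Metric.closedBall 0 1) (Metric.closedBall 0 1) := by
    intro h hh
    rw [mem_closedBall_zero_iff] at hh ⊢
    refine (hbound h hh).trans ?_
    nlinarith [mul_nonneg hK hM]
  have hcontr : ContractingWith (1 / 2) (hmaps.restrict Φ _ _) := by
    refine ⟨by norm_num, LipschitzWith.of_dist_le_mul ?_⟩
    rintro ⟨h, hh⟩ ⟨h', hh'⟩
    rw [mem_closedBall_zero_iff] at hh hh'
    rw [Subtype.dist_eq, Subtype.dist_eq, dist_eq_norm, dist_eq_norm]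
    simpa using hlip h h' hh hh'
  obtain ⟨h, hh, hfix, -⟩ := ContractingWith.exists_fixedPoint'
    (Metric.isClosed_closedBall (x := (0 : C(Circ, ℂ))) (ε := 1)).isComplete hmaps hcontr
    (Metric.mem_closedBall_self zero_le_one) (edist_ne_top _ _)
  rw [mem_closedBall_zero_iff] at hh
  have hfix' : Φ h = h := hfix
  refine ⟨h, ?_, fun n => ?_⟩
  · rw [← hfix']; exact hbound h hh
  · conv_lhs => rw [← hfix']
    exact circleCoeff_reducedResolvent hK hs hsK _ n

end

/-! ### Localization, orthogonality and discreteness of the spectrum -/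

/-- The eigenvalue equation `(-i d/dθ + δ)² v + q v = z v` on the circle, written in Fourier
coefficients. -/
def IsFourierEigen (δ : ℝ) (q : C(Circ, ℂ)) (z : ℂ) (v : C(Circ, ℂ)) : Prop :=
  ∀ n : ℤ, ((((n : ℝ) + δ) ^ 2 : ℝ) : ℂ) * circleCoeff n v = z * circleCoeff n v - circleCoeff n (q * v)

namespace IsFourierEigen

variable {δ : ℝ} {q v w : C(Circ, ℂ)} {z z' : ℂ}

theorem smul (h : IsFourierEigen δ q z v) (c : ℂ) : IsFourierEigen δ q z (c • v) := by
  intro n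
  have e : q * c • v = c • (q * v) := by rw [mul_smul_comm]
  rw [e, map_smul, map_smul, smul_eq_mul, smul_eq_mul]
  linear_combination c * h n

theorem sub_mul_circleCoeff (h : IsFourierEigen δ q z v) (n : ℤ) :
    (z - ((((n : ℝ) + δ) ^ 2 : ℝ) : ℂ)) * circleCoeff n v = circleCoeff n (q * v) := by
  linear_combination -h n

/-- Every eigenvalue is within `‖q‖` of the spectrum of the unperturbed operator. -/
theorem exists_norm_sub_le (h : IsFourierEigen δ q z v) (hv : v ≠ 0) :
    ∃ n : ℤ, ‖z - ((((n : ℝ) + δ) ^ 2 : ℝ) : ℂ)‖ ≤ ‖q‖ := by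
  -- If every entry were farther than `‖q‖` from `z`, Parseval would give `‖q v‖ > ‖q‖ ‖v‖` in `L²`.
  by_contra! hcon
  have h1 := hasSum_norm_sq_circleCoeff (q * v)
  have h2 := (hasSum_norm_sq_circleCoeff v).mul_left (‖q‖ ^ 2)
  have hle : ∀ n, ‖q‖ ^ 2 * ‖circleCoeff n v‖ ^ 2 ≤ ‖circleCoeff n (q * v)‖ ^ 2 := by
    intro n
    rw [← h.sub_mul_circleCoeff n, norm_mul, mul_pow]
    gcongr
    exact (hcon n).le
  obtain ⟨m, hm⟩ : ∃ m, circleCoeff m v ≠ 0 := by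
    by_contra! h0
    exact hv (eq_of_circleCoeff_eq fun n => by rw [h0, map_zero])
  have hlt : ‖q‖ ^ 2 * ‖circleCoeff m v‖ ^ 2 < ‖circleCoeff m (q * v)‖ ^ 2 := by
    rw [← h.sub_mul_circleCoeff m, norm_mul, mul_pow]
    have : 0 < ‖circleCoeff m v‖ := norm_pos_iff.mpr hm
    gcongr
    exact hcon m
  have h3 := hasSum_lt hle hlt h2 h1
  have h4 : ‖circleL2 (q * v)‖ ^ 2 ≤ (‖q‖ * ‖circleL2 v‖) ^ 2 :=
    pow_le_pow_left₀ (norm_nonneg _) (norm_circleL2_mul_le q v) 2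
  rw [mul_pow] at h4
  exact absurd h3 (not_lt.mpr h4)

/-- Symmetry of the operator, read off coefficient by coefficient: the diagonal part is real and
multiplication by `q` is self-adjoint. No derivative of `v` or `w` enters. -/
theorem sub_mul_inner_eq_zero (hq : star q = q) (hv : IsFourierEigen δ q z v)
    (hw : IsFourierEigen δ q z' w) :
    (z' - conj z) * inner ℂ (circleL2 v) (circleL2 w) = 0 := by
  have h0 := hasSum_inner_circleCoeff v w
  have h1 := (h0.mul_left z').sub (hasSum_inner_circleCoeff v (q * w))
  have h2 := (h0.mul_left (conj z)).sub (hasSum_inner_circleCoeff (q * v) w)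
  have e : (fun n => z' * (conj (circleCoeff n v) * circleCoeff n w)
      - conj (circleCoeff n v) * circleCoeff n (q * w))
      = fun n => conj z * (conj (circleCoeff n v) * circleCoeff n w)
      - conj (circleCoeff n (q * v)) * circleCoeff n w := by
    funext n
    have a1 := hw n
    have a2 := congrArg conj (hv n)
    simp only [map_mul, map_sub, Complex.conj_ofReal] at a2
    linear_combination -conj (circleCoeff n v) * a1 + circleCoeff n w * a2
  rw [e] at h1
  have h3 := h1.unique h2
  rw [inner_circleL2_mul, hq] at h3
  linear_combination h3

theorem conj_eq (hq : star q = q) (hv : IsFourierEigen δ q z v) (h0 : v ≠ 0) : conj z = z := by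
  have h := hv.sub_mul_inner_eq_zero hq hv
  rcases mul_eq_zero.mp h with h | h
  · exact (sub_eq_zero.mp h).symm
  · exact absurd (inner_self_eq_zero.mp h) (circleL2_ne_zero h0)

theorem inner_eq_zero (hq : star q = q) {s t : ℝ} (hst : s ≠ t) (hv : IsFourierEigen δ q s v)
    (hw : IsFourierEigen δ q t w) : inner ℂ (circleL2 v) (circleL2 w) = 0 := by
  have h := hv.sub_mul_inner_eq_zero hq hw
  rcases mul_eq_zero.mp h with h | h
  · rw [Complex.conj_ofReal, sub_eq_zero] at h
    exact absurd (Complex.ofReal_injective h).symm hst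
  · exact h

/-- An eigenfunction for an eigenvalue close to `(j + δ)²` is not orthogonal to small perturbations
of `fourier j`. -/
theorem inner_fourier_add_ne_zero {κ W : ℝ} (hδ : IsNonresonant δ κ) {j : ℤ} (hj : j ≠ 0)
    (hv : IsFourierEigen δ q z v) (h0 : v ≠ 0) (hz : ‖z - ((((j : ℝ) + δ) ^ 2 : ℝ) : ℂ)‖ ≤ W)
    (hW : W + 2 * ‖q‖ < κ / 2 * |(j : ℝ)|) {h : C(Circ, ℂ)} (hh : ‖h‖ ≤ 1 / 2) :
    inner ℂ (circleL2 (fourier j + h)) (circleL2 v) ≠ 0 := by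
  intro hin
  have hM := norm_nonneg q
  have hvj : circleCoeff j v = -inner ℂ (circleL2 h) (circleL2 v) := by
    rw [map_add, inner_add_left] at hin
    exact eq_neg_of_add_eq_zero_left hin
  have hvpos : 0 < ‖circleL2 v‖ := norm_pos_iff.mpr (circleL2_ne_zero h0)
  have hvj' : ‖circleCoeff j v‖ ^ 2 ≤ 1 / 4 * ‖circleL2 v‖ ^ 2 := by
    have : ‖circleCoeff j v‖ ≤ 1 / 2 * ‖circleL2 v‖ := by
      rw [hvj, norm_neg]
      refine (norm_inner_le_norm _ _).trans ?_
      gcongr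
      exact (norm_circleL2_le h).trans hh
    have := pow_le_pow_left₀ (norm_nonneg _) this 2
    nlinarith
  -- `D` bounds from below the distance of `z` to every entry other than `(j + δ)²`. The
  -- coefficients off `j` then carry at most `(‖q‖ / D)² ≤ 1/4` of the mass of `v`. Orthogonality
  -- leaves at most `1/4` at `j`, and the total falls short of one.
  set D := κ / 2 * |(j : ℝ)| - W with hD
  have hD2 : 2 * ‖q‖ < D := by linarith
  have hDpos : 0 < D := by linarith
  have hother : ∀ n, n ≠ j → ‖circleCoeff n v‖ ^ 2 ≤ (D⁻¹) ^ 2 * ‖circleCoeff n (q * v)‖ ^ 2 := by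
    intro n hn
    have g := hδ.gap hj hn
    have e : ‖((((n : ℝ) + δ) ^ 2 : ℝ) : ℂ) - ((((j : ℝ) + δ) ^ 2 : ℝ) : ℂ)‖
        = |((j : ℝ) + δ) ^ 2 - ((n : ℝ) + δ) ^ 2| := by
      rw [← Complex.ofReal_sub, Complex.norm_real, Real.norm_eq_abs, abs_sub_comm]
    have e2 := norm_sub_le (z - ((((j : ℝ) + δ) ^ 2 : ℝ) : ℂ)) (z - ((((n : ℝ) + δ) ^ 2 : ℝ) : ℂ))
    have e3 : z - ((((j : ℝ) + δ) ^ 2 : ℝ) : ℂ) - (z - ((((n : ℝ) + δ) ^ 2 : ℝ) : ℂ))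
      = ((((n : ℝ) + δ) ^ 2 : ℝ) : ℂ) - ((((j : ℝ) + δ) ^ 2 : ℝ) : ℂ) := by ring
    rw [e3, e] at e2
    have hDn : D ≤ ‖z - ((((n : ℝ) + δ) ^ 2 : ℝ) : ℂ)‖ := by linarith
    rw [← mul_pow]
    refine pow_le_pow_left₀ (norm_nonneg _) ?_ 2
    rw [← hv.sub_mul_circleCoeff n, norm_mul, ← mul_assoc]
    refine le_mul_of_one_le_left (norm_nonneg _) ?_
    rw [inv_mul_eq_div, one_le_div hDpos]
    exact hDn
  have s1 := hasSum_norm_sq_circleCoeff v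
  have s2 := (hasSum_norm_sq_circleCoeff (q * v)).mul_left ((D⁻¹) ^ 2)
  have s3 := hasSum_ite_eq j (1 / 4 * ‖circleL2 v‖ ^ 2)
  have hle := hasSum_le (fun n => ?_) s1 (s3.add s2)
  · have h4 : ‖circleL2 (q * v)‖ ^ 2 ≤ (‖q‖ * ‖circleL2 v‖) ^ 2 :=
      pow_le_pow_left₀ (norm_nonneg _) (norm_circleL2_mul_le q v) 2
    have h5 : D⁻¹ ^ 2 * ‖circleL2 (q * v)‖ ^ 2 ≤ 1 / 4 * ‖circleL2 v‖ ^ 2 := by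
      have : D⁻¹ * ‖q‖ ≤ 1 / 2 := by
        rw [inv_mul_eq_div, div_le_div_iff₀ hDpos two_pos]; linarith
      have h6 : (D⁻¹ * ‖q‖) ^ 2 ≤ (1 / 2) ^ 2 := pow_le_pow_left₀ (by positivity) this 2
      calc _ ≤ D⁻¹ ^ 2 * (‖q‖ * ‖circleL2 v‖) ^ 2 := by gcongr
        _ = (D⁻¹ * ‖q‖) ^ 2 * ‖circleL2 v‖ ^ 2 := by ring
        _ ≤ (1 / 2) ^ 2 * ‖circleL2 v‖ ^ 2 := by gcongr
        _ = _ := by norm_num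
    nlinarith [pow_pos hvpos 2]
  · by_cases hn : n = j
    · subst hn
      simp only [if_true]
      exact hvj'.trans (le_add_of_nonneg_right (by positivity))
    · simp only [hn, if_false, zero_add]
      exact hother n hn

end IsFourierEigen

/-- The real eigenvalues of `(-i d/dθ + δ)² + q` on the circle. -/
def fourierSpectrum (δ : ℝ) (q : C(Circ, ℂ)) : Set ℝ :=
  {t | ∃ v, v ≠ 0 ∧ IsFourierEigen δ q t v}

theorem abs_sub_le_of_mem_fourierSpectrum {δ : ℝ} {q : C(Circ, ℂ)} {t : ℝ}
    (ht : t ∈ fourierSpectrum δ q) : ∃ n : ℤ, |t - ((n : ℝ) + δ) ^ 2| ≤ ‖q‖ := by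
  obtain ⟨v, h0, hv⟩ := ht
  obtain ⟨n, hn⟩ := hv.exists_norm_sub_le h0
  refine ⟨n, ?_⟩
  rwa [← Complex.ofReal_sub, Complex.norm_real, Real.norm_eq_abs] at hn

theorem neg_norm_le_of_mem_fourierSpectrum {δ : ℝ} {q : C(Circ, ℂ)} {t : ℝ}
    (ht : t ∈ fourierSpectrum δ q) : -‖q‖ ≤ t := by
  obtain ⟨n, hn⟩ := abs_sub_le_of_mem_fourierSpectrum ht
  have := (abs_le.mp hn).1
  nlinarith [sq_nonneg ((n : ℝ) + δ)]

/-- A counting substitute for compactness of the resolvent. Normalized eigenfunctions for distinct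
eigenvalues are orthonormal; those with eigenvalue at most `T` carry at least `3/4` of their mass on
a fixed finite set `F` of frequencies. By Bessel each frequency receives total mass at most one, so
there are at most `4/3 * F.card` of them. -/
theorem fourierSpectrum_inter_Iic_finite {δ : ℝ} (hδ : |δ| ≤ 1 / 2) {q : C(Circ, ℂ)}
    (hq : star q = q) (T : ℝ) : (fourierSpectrum δ q ∩ Set.Iic T).Finite := by
  by_contra hinf
  have hM := norm_nonneg q
  -- `Q` bounds the `L²` norm of `t w - q w` for a normalized eigenfunction `w`. Outside `F` the
  -- entries `(n + δ)²` are at least `N ≥ 2 * Q`, so the tail mass is at most `1/4`.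
  set Q : ℝ := |T| + 2 * ‖q‖ + 1 with hQ
  have hQpos : 0 < Q := by positivity
  obtain ⟨N, hN⟩ := exists_nat_ge (2 * Q)
  set F : Finset ℤ := Finset.Icc (-(N : ℤ)) N with hF
  obtain ⟨s, hs, hcard⟩ := Set.Infinite.exists_subset_card_eq hinf (2 * F.card + 1)
  choose! v hv using fun t (ht : t ∈ fourierSpectrum δ q ∩ Set.Iic T) => ht.1
  set w : ℝ → C(Circ, ℂ) := fun t => ((‖circleL2 (v t)‖⁻¹ : ℝ) : ℂ) • v t with hw
  have hnorm : ∀ t ∈ s, ‖circleL2 (w t)‖ = 1 := by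
    intro t ht
    have h0 : ‖circleL2 (v t)‖ ≠ 0 := norm_ne_zero_iff.mpr (circleL2_ne_zero (hv t (hs ht)).1)
    rw [hw, map_smul, norm_smul, Complex.norm_real, norm_inv, norm_norm, inv_mul_cancel₀ h0]
  have hweig : ∀ t ∈ s, IsFourierEigen δ q t (w t) := fun t ht => (hv t (hs ht)).2.smul _
  have horth : Orthonormal ℂ (fun t : s => circleL2 (w t)) := by
    refine ⟨fun t => hnorm t t.2, fun t t' htt' => ?_⟩
    exact (hweig t t.2).inner_eq_zero hq (fun h => htt' (Subtype.ext h)) (hweig t' t'.2)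
  have hbessel : ∀ n : ℤ, ∑ t ∈ s, ‖circleCoeff n (w t)‖ ^ 2 ≤ 1 := by
    intro n
    have h := horth.sum_inner_products_le (fourierLp (T := 2 * Real.pi) 2 n) (s := Finset.univ)
    rw [(orthonormal_fourier (T := 2 * Real.pi)).1 n, one_pow] at h
    rw [← Finset.sum_coe_sort]
    refine le_trans (le_of_eq ?_) h
    refine Finset.sum_congr rfl fun t _ => ?_
    rw [← inner_conj_symm, RCLike.norm_conj]
    rfl
  have htail : ∀ t ∈ s, 3 / 4 ≤ ∑ n ∈ F, ‖circleCoeff n (w t)‖ ^ 2 := by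
    intro t ht
    have htT : t ≤ T := (hs ht).2
    have htM := neg_norm_le_of_mem_fourierSpectrum (hs ht).1
    have habs : |t| ≤ |T| + ‖q‖ := by
      rw [abs_le]
      constructor
      · linarith [abs_nonneg T]
      · linarith [le_abs_self T]
    set u : C(Circ, ℂ) := (t : ℂ) • w t - q * w t with hu
    have huN : ‖circleL2 u‖ ≤ Q := by
      rw [hu, map_sub, map_smul]
      refine (norm_sub_le _ _).trans ?_
      rw [norm_smul, Complex.norm_real, Real.norm_eq_abs, hnorm t ht]
      have := norm_circleL2_mul_le q (w t)
      rw [hnorm t ht] at this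
      linarith
    have s1 := hasSum_norm_sq_circleCoeff (w t)
    have s2 := (hasSum_norm_sq_circleCoeff u).mul_left ((2 * Q)⁻¹ ^ 2)
    have s3 : HasSum (fun n => if n ∈ F then ‖circleCoeff n (w t)‖ ^ 2 else 0)
        (∑ n ∈ F, ‖circleCoeff n (w t)‖ ^ 2) := by
      have : HasSum (fun n => if n ∈ F then ‖circleCoeff n (w t)‖ ^ 2 else 0)
          (∑ n ∈ F, if n ∈ F then ‖circleCoeff n (w t)‖ ^ 2 else 0) :=
        hasSum_sum_of_ne_finset_zero fun n hn => by simp only [hn, if_false]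
      convert this using 1
      exact Finset.sum_congr rfl fun n hn => by simp only [hn, if_true]
    have hle := hasSum_le (fun n => ?_) s1 (s3.add s2)
    · rw [hnorm t ht] at hle
      have : (2 * Q)⁻¹ ^ 2 * ‖circleL2 u‖ ^ 2 ≤ (2 * Q)⁻¹ ^ 2 * Q ^ 2 := by gcongr
      have e : (2 * Q)⁻¹ ^ 2 * Q ^ 2 = 1 / 4 := by field_simp; norm_num
      linarith
    · by_cases hn : n ∈ F
      · simp only [hn, if_true]
        exact le_add_of_nonneg_right (by positivity)
      · simp only [hn, if_false, zero_add]
        rw [← mul_pow]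
        refine pow_le_pow_left₀ (norm_nonneg _) ?_ 2
        have e : circleCoeff n u = ((((n : ℝ) + δ) ^ 2 : ℝ) : ℂ) * circleCoeff n (w t) := by
          rw [hu, map_sub, map_smul, smul_eq_mul, hweig t ht n]
        rw [e, norm_mul, Complex.norm_real, Real.norm_eq_abs, abs_of_nonneg (sq_nonneg _),
          ← mul_assoc]
        refine le_mul_of_one_le_left (norm_nonneg _) ?_
        rw [inv_mul_eq_div, one_le_div (by positivity)]
        refine hN.trans ?_
        have hn' : (N : ℤ) + 1 ≤ |n| := by
          rw [hF, Finset.mem_Icc, ← abs_le] at hn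
          omega
        have hn2 : (N : ℝ) + 1 ≤ |(n : ℝ)| := by exact_mod_cast hn'
        have h3 := abs_sub_abs_le_abs_sub (n : ℝ) (-δ)
        rw [abs_neg, sub_neg_eq_add] at h3
        rw [← sq_abs]
        have h4 : (N : ℝ) + 1 / 2 ≤ |(n : ℝ) + δ| := by linarith
        have hN0 : (0 : ℝ) ≤ N := Nat.cast_nonneg N
        nlinarith
  have h1 : (s.card : ℝ) * (3 / 4) ≤ F.card := by
    calc (s.card : ℝ) * (3 / 4) = ∑ t ∈ s, (3 / 4 : ℝ) := by simp
      _ ≤ ∑ t ∈ s, ∑ n ∈ F, ‖circleCoeff n (w t)‖ ^ 2 := Finset.sum_le_sum htail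
      _ = ∑ n ∈ F, ∑ t ∈ s, ‖circleCoeff n (w t)‖ ^ 2 := Finset.sum_comm
      _ ≤ ∑ n ∈ F, (1 : ℝ) := Finset.sum_le_sum fun n _ => hbessel n
      _ = F.card := by simp
  rw [hcard] at h1
  push_cast at h1
  have : (0 : ℝ) ≤ F.card := Nat.cast_nonneg _
  linarith

/-! ### Perturbation of a single eigenvalue -/

theorem fourier_zero_eq_one : (fourier 0 : C(Circ, ℂ)) = 1 := by
  ext x; simp

/-- Cancellation between the frequencies `j + m` and `j - m`. -/
theorem abs_resolventCoeff_add_le {δ κ : ℝ} (hδ : IsNonresonant δ κ) {j : ℤ} (hj : j ≠ 0) (m : ℤ) :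
    |resolventCoeff δ j (j + m) + resolventCoeff δ j (j - m)|
      ≤ (m : ℝ) ^ 2 * (resolventCoeff δ j (j + m) ^ 2 + resolventCoeff δ j (j - m) ^ 2) := by
  rcases eq_or_ne m 0 with rfl | hm
  · simp [resolventCoeff_self]
  have hjpos : 0 < κ / 2 * |(j : ℝ)| :=
    mul_pos (by linarith [hδ.pos]) (abs_pos.mpr (by exact_mod_cast hj))
  have g1 := hjpos.trans_le (hδ.gap hj (n := j + m) (by simpa using hm))
  have g2 := hjpos.trans_le (hδ.gap hj (n := j - m) (by simpa using hm))
  have d1 := abs_pos.mp g1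
  have d2 := abs_pos.mp g2
  have e : resolventCoeff δ j (j + m) + resolventCoeff δ j (j - m)
      = -2 * (m : ℝ) ^ 2 * (resolventCoeff δ j (j + m) * resolventCoeff δ j (j - m)) := by
    unfold resolventCoeff
    rw [inv_add_inv d1 d2, ← mul_inv, ← div_eq_mul_inv]
    congr 1
    push_cast
    ring
  rw [e, abs_mul, abs_mul, abs_of_nonneg (sq_nonneg (m : ℝ)), abs_mul]
  norm_num
  have : 2 * (|resolventCoeff δ j (j + m)| * |resolventCoeff δ j (j - m)|)
      ≤ resolventCoeff δ j (j + m) ^ 2 + resolventCoeff δ j (j - m) ^ 2 := by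
    rw [← sq_abs (resolventCoeff δ j (j + m)), ← sq_abs (resolventCoeff δ j (j - m))]
    nlinarith [sq_nonneg (|resolventCoeff δ j (j + m)| - |resolventCoeff δ j (j - m)|)]
  nlinarith [sq_nonneg (m : ℝ)]

theorem hasSum_shift_and_reflect {f : ℤ → ℝ} (hf : Summable f) (j : ℤ) :
    HasSum (fun m => f (j + m)) (∑' n, f n) ∧ HasSum (fun m => f (j - m)) (∑' n, f n) :=
  ⟨(Equiv.addLeft j).hasSum_iff.mpr hf.hasSum, (Equiv.subLeft j).hasSum_iff.mpr hf.hasSum⟩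

/-- The second order term of the perturbation series is `O(j⁻²)`. -/
theorem abs_tsum_resolventCoeff_mul_le {δ κ K B : ℝ} (hδ : IsNonresonant δ κ) {j : ℤ} (hj : j ≠ 0)
    (hs : Summable (fun n => resolventCoeff δ j n ^ 2))
    (hsK : ∑' n, resolventCoeff δ j n ^ 2 ≤ K ^ 2) {p : C(Circ, ℂ)} (hp : star p = p)
    (hB : ∀ m : ℤ, |(m : ℝ)| * ‖circleCoeff m p‖ ≤ B) :
    Summable (fun n => resolventCoeff δ j n * ‖circleCoeff (n - j) p‖ ^ 2) ∧
      |∑' n, resolventCoeff δ j n * ‖circleCoeff (n - j) p‖ ^ 2| ≤ B ^ 2 * K ^ 2 := by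
  set r := resolventCoeff δ j with hr
  set f : ℤ → ℝ := fun n => r n * ‖circleCoeff (n - j) p‖ ^ 2 with hf
  have hP : Summable (fun n => ‖circleCoeff (n - j) p‖ ^ 2) :=
    ((Equiv.subRight j).summable_iff (f := fun n => ‖circleCoeff n p‖ ^ 2)).mpr
      (hasSum_norm_sq_circleCoeff p).summable
  have hfs : Summable f := by
    refine Summable.of_norm_bounded (hP.mul_left (2 / κ / |(j : ℝ)|)) fun n => ?_
    rw [Real.norm_eq_abs, abs_mul, abs_of_nonneg (sq_nonneg (‖circleCoeff (n - j) p‖))]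
    exact mul_le_mul_of_nonneg_right (hδ.abs_resolventCoeff_le hj n) (sq_nonneg _)
  refine ⟨hfs, ?_⟩
  obtain ⟨f1, f2⟩ := hasSum_shift_and_reflect hfs j
  obtain ⟨r1, r2⟩ := hasSum_shift_and_reflect hs j
  -- Since `p` is real, `|p_m| = |p_{-m}|`, so the terms at `j + m` and `j - m` share a weight and
  -- their multipliers can be added before estimating.
  have hb : ∀ m, ‖f (j + m) + f (j - m)‖ ≤ B ^ 2 * (r (j + m) ^ 2 + r (j - m) ^ 2) := by
    intro m
    have e1 : ‖circleCoeff (-m) p‖ = ‖circleCoeff m p‖ := by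
      have := circleCoeff_star p (-m)
      rw [hp, neg_neg] at this
      rw [this, RCLike.norm_conj]
    have e2 : f (j + m) + f (j - m) = (r (j + m) + r (j - m)) * ‖circleCoeff m p‖ ^ 2 := by
      simp only [hf]
      rw [add_sub_cancel_left, sub_sub_cancel_left, e1]
      ring
    rw [e2, Real.norm_eq_abs, abs_mul, abs_of_nonneg (sq_nonneg ‖circleCoeff m p‖)]
    have h1 := abs_resolventCoeff_add_le hδ hj m
    have h2 : (|(m : ℝ)| * ‖circleCoeff m p‖) ^ 2 ≤ B ^ 2 :=
      pow_le_pow_left₀ (by positivity) (hB m) 2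
    rw [mul_pow, sq_abs] at h2
    calc _ ≤ ((m : ℝ) ^ 2 * (r (j + m) ^ 2 + r (j - m) ^ 2)) * ‖circleCoeff m p‖ ^ 2 := by gcongr
      _ = ((m : ℝ) ^ 2 * ‖circleCoeff m p‖ ^ 2) * (r (j + m) ^ 2 + r (j - m) ^ 2) := by ring
      _ ≤ _ := by gcongr
  -- Summing over all integers `m` counts every frequency twice on both sides; the factor `2`
  -- cancels.
  have h3 := tsum_of_norm_bounded ((r1.add r2).mul_left (B ^ 2)) hb
  rw [(f1.add f2).tsum_eq, Real.norm_eq_abs] at h3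
  have h4 : |∑' n, f n + ∑' n, f n| = 2 * |∑' n, f n| := by
    rw [← two_mul, abs_mul, abs_two]
  rw [h4] at h3
  nlinarith [sq_nonneg B]

/-- The fixed point gives the eigenpair and the size of `h`. For the eigenvalue, inserting the fixed
point equation once into the shift isolates the second order sum, bounded by cancellation, from a
third order remainder. -/
theorem exists_perturbed_eigenpair {δ κ : ℝ} (hδ : IsNonresonant δ κ) {q : C(Circ, ℂ)}
    (hq : star q = q) {c B : ℝ} (hc : circleCoeff 0 q = c)
    (hB : ∀ m : ℤ, |(m : ℝ)| * ‖circleCoeff m q‖ ≤ B) :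
    ∃ C : ℝ, 0 < C ∧ ∃ N : ℝ, 0 < N ∧ ∀ j : ℤ, N ≤ |(j : ℝ)| → ∃ (ε : ℝ) (h : C(Circ, ℂ)),
      ‖h‖ ≤ C / |(j : ℝ)| ∧ |ε| ≤ C / |(j : ℝ)| ^ 2 ∧ circleCoeff j h = 0 ∧
      IsFourierEigen δ q ((c + ((j : ℝ) + δ) ^ 2 + ε : ℝ) : ℂ) (fourier j + h) := by
  obtain ⟨C0, hC0, hres⟩ := hδ.exists_tsum_sq_resolventCoeff_le
  -- Removing the mean moves the whole first order shift into `c` and makes the coefficient of `p *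
  -- fourier j` at `j` vanish.
  set p : C(Circ, ℂ) := q - (c : ℂ) • (1 : C(Circ, ℂ)) with hp
  set M := ‖p‖ with hM
  have hM0 : 0 ≤ M := norm_nonneg _
  have hpstar : star p = p := by
    rw [hp, star_sub, hq, star_smul, star_one]
    simp
  have hqp : ∀ v, q * v = p * v + (c : ℂ) • v := by
    intro v
    rw [hp, sub_mul, smul_mul_assoc, one_mul, sub_add_cancel]
  have hp0 : circleCoeff 0 p = 0 := by
    rw [hp, map_sub, map_smul, hc, ← fourier_zero_eq_one, circleCoeff_fourier]
    simp
  have hpB : ∀ m : ℤ, |(m : ℝ)| * ‖circleCoeff m p‖ ≤ B := by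
    intro m
    rcases eq_or_ne m 0 with rfl | hm
    · simpa using hB 0
    · have : circleCoeff m p = circleCoeff m q := by
        rw [hp, map_sub, map_smul, ← fourier_zero_eq_one, circleCoeff_fourier]
        simp [hm]
      rw [this]; exact hB m
  -- The first summand serves `h`, the second `ε`, and `1` gives positivity. The threshold `6 * C0 *
  -- M + 1` ensures the contraction condition `6 * K * M ≤ 1`.
  refine ⟨3 * C0 * M + (B ^ 2 + 6 * M ^ 3) * C0 ^ 2 + 1, by positivity, 6 * C0 * M + 1,
    by positivity, fun j hj => ?_⟩
  have hj1 : (0 : ℝ) < |(j : ℝ)| := by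
    have : 0 ≤ 6 * C0 * M := by positivity
    linarith
  have hj0 : j ≠ 0 := by
    rintro rfl
    simp at hj1
  obtain ⟨hs, hsK⟩ := hres j hj0
  set K := C0 / |(j : ℝ)| with hK
  have hKpos : 0 ≤ K := by positivity
  have hKM : 6 * K * M ≤ 1 := by
    rw [hK]
    have : 6 * (C0 / |(j : ℝ)|) * M = (6 * C0 * M) / |(j : ℝ)| := by ring
    rw [this, div_le_one hj1]
    linarith
  obtain ⟨h, hh, hcoef⟩ := exists_fixedPoint_reducedResolvent hKpos hs hsK p hKM
  have hhj : circleCoeff j h = 0 := by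
    rw [hcoef, resolventCoeff_self]; simp
  set e := circleCoeff j (p * h) with he
  set g : C(Circ, ℂ) := fourier j + h with hg
  have hgj : circleCoeff j g = 1 := by
    rw [hg, map_add, hhj, circleCoeff_fourier]; simp
  have hg0 : g ≠ 0 := by
    intro h0
    rw [h0, map_zero] at hgj
    exact zero_ne_one hgj
  have heig : IsFourierEigen δ q ((c : ℂ) + ((((j : ℝ) + δ) ^ 2 : ℝ) : ℂ) + e) g := by
    intro n
    have e0 : circleCoeff n (q * g) = circleCoeff n (p * g) + c * circleCoeff n g := by
      rw [hqp, map_add, map_smul, smul_eq_mul]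
    rw [e0]
    rcases eq_or_ne n j with rfl | hn
    · have e1 : circleCoeff n (p * g) = e := by
        rw [hg, mul_add, map_add, circleCoeff_mul_fourier, sub_self, hp0, zero_add]
      rw [e1, hgj]
      ring
    · have hjpos : 0 < κ / 2 * |(j : ℝ)| := mul_pos (by linarith [hδ.pos]) hj1
      have g1 := abs_pos.mp (hjpos.trans_le (hδ.gap hj0 hn))
      have e1 : circleCoeff n g = circleCoeff n h := by
        rw [hg, map_add, circleCoeff_fourier, if_neg hn, zero_add]
      have e2 : circleCoeff n (p * fourier j + p * h - e • h)
          = circleCoeff n (p * g) - e * circleCoeff n g := by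
        rw [e1, hg, mul_add, map_sub, map_smul, smul_eq_mul]
      have e3 := hcoef n
      rw [e2, ← e1, resolventCoeff] at e3
      have e4 : (((((j : ℝ) + δ) ^ 2 - ((n : ℝ) + δ) ^ 2 : ℝ)) : ℂ) * circleCoeff n g
          = circleCoeff n (p * g) - e * circleCoeff n g := by
        conv_lhs => rw [e3]
        rw [← mul_assoc, ← Complex.ofReal_mul, mul_inv_cancel₀ g1]
        simp
      push_cast at e4 ⊢
      linear_combination -e4
  -- The fixed point gives a shift that is a priori complex; symmetry of the operator makes it real.
  have hereal : conj e = e := by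
    have := heig.conj_eq hq hg0
    simp only [map_add, Complex.conj_ofReal] at this
    exact add_left_cancel this
  obtain ⟨ε, hε⟩ := Complex.conj_eq_iff_real.mp hereal
  have hh1 : ‖h‖ ≤ 1 := hh.trans (by nlinarith)
  have heM : ‖e‖ ≤ M * ‖h‖ :=
    (norm_circleCoeff_le _ _).trans ((norm_circleL2_le _).trans (norm_mul_le _ _))
  -- second order expansion of the eigenvalue
  set U : C(Circ, ℂ) := p * h - e • h with hU
  have hUn : ‖circleL2 U‖ ≤ 2 * M * ‖h‖ := by
    refine (norm_circleL2_le _).trans ((norm_sub_le _ _).trans ?_)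
    have a1 : ‖p * h‖ ≤ M * ‖h‖ := norm_mul_le _ _
    have a2 : ‖e • h‖ ≤ M * ‖h‖ := by
      rw [norm_smul]
      exact (mul_le_of_le_one_right (norm_nonneg _) hh1).trans heM
    linarith
  obtain ⟨t1s, t1⟩ := abs_tsum_resolventCoeff_mul_le hδ hj0 hs hsK hpstar hpB
  obtain ⟨t2s, t2⟩ := summable_resolventCoeff_mul hKpos hs hsK U
  -- As `p` is real, the shift `e = circleCoeff j (p * h)` is the inner product of `p * fourier j`
  -- with `h`, to which Parseval applies.
  have hsum : HasSum (fun n => conj (circleCoeff n (p * fourier j)) * circleCoeff n h) e := by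
    have a := hasSum_inner_circleCoeff (p * fourier j) h
    rw [inner_circleL2_mul, hpstar] at a
    exact a
  have hT1 : HasSum (fun n => ((resolventCoeff δ j n * ‖circleCoeff (n - j) p‖ ^ 2 : ℝ) : ℂ))
      ((∑' n, resolventCoeff δ j n * ‖circleCoeff (n - j) p‖ ^ 2 : ℝ) : ℂ) :=
    Complex.hasSum_ofReal.mpr t1s.hasSum
  have hdiff := hsum.sub hT1
  have hbound : ∀ n, ‖conj (circleCoeff n (p * fourier j)) * circleCoeff n h
      - ((resolventCoeff δ j n * ‖circleCoeff (n - j) p‖ ^ 2 : ℝ) : ℂ)‖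
      ≤ M * (|resolventCoeff δ j n| * ‖circleCoeff n U‖) := by
    intro n
    have a1 : circleCoeff n h = (resolventCoeff δ j n : ℂ) *
        (circleCoeff n (p * fourier j) + circleCoeff n U) := by
      rw [hcoef n, hU, add_sub_assoc, map_add]
    rw [a1, circleCoeff_mul_fourier]
    have a2 : conj (circleCoeff (n - j) p) * ((resolventCoeff δ j n : ℂ) *
        (circleCoeff (n - j) p + circleCoeff n U))
        - ((resolventCoeff δ j n * ‖circleCoeff (n - j) p‖ ^ 2 : ℝ) : ℂ)
        = conj (circleCoeff (n - j) p) * ((resolventCoeff δ j n : ℂ) * circleCoeff n U) := by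
      have := Complex.conj_mul' (circleCoeff (n - j) p)
      push_cast
      linear_combination (resolventCoeff δ j n : ℂ) * this
    rw [a2, norm_mul, norm_mul, RCLike.norm_conj, Complex.norm_real, Real.norm_eq_abs]
    exact mul_le_mul_of_nonneg_right ((norm_circleCoeff_le _ _).trans (norm_circleL2_le _))
      (by positivity)
  have hfin := tsum_of_norm_bounded (t2s.hasSum.mul_left M) hbound
  rw [hdiff.tsum_eq] at hfin
  have hee : |ε| ≤ (B ^ 2 + 6 * M ^ 3) * K ^ 2 := by
    have b1 : |ε| = ‖e‖ := by rw [hε, Complex.norm_real, Real.norm_eq_abs]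
    have b2 := norm_le_norm_sub_add e
      ((∑' n, resolventCoeff δ j n * ‖circleCoeff (n - j) p‖ ^ 2 : ℝ) : ℂ)
    rw [Complex.norm_real, Real.norm_eq_abs] at b2
    -- Third order remainder: the resolvent contributes `K`, `U` at most `2 * M * ‖h‖`, and `‖h‖ ≤ 3
    -- * K * M`.
    have b3 : M * ∑' n, |resolventCoeff δ j n| * ‖circleCoeff n U‖ ≤ 6 * M ^ 3 * K ^ 2 := by
      have : ∑' n, |resolventCoeff δ j n| * ‖circleCoeff n U‖ ≤ K * (2 * M * (3 * K * M)) := by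
        refine t2.trans ?_
        gcongr
        exact hUn.trans (by gcongr)
      calc _ ≤ M * (K * (2 * M * (3 * K * M))) := by gcongr
        _ = _ := by ring
    rw [b1]
    linarith
  refine ⟨ε, h, ?_, ?_, hhj, ?_⟩
  · refine hh.trans ?_
    rw [hK, mul_div_assoc', div_mul_eq_mul_div]
    gcongr
    have : 0 ≤ (B ^ 2 + 6 * M ^ 3) * C0 ^ 2 := by positivity
    linarith
  · refine hee.trans ?_
    rw [hK, div_pow, mul_div_assoc']
    gcongr
    have : 0 ≤ 3 * C0 * M := by positivity
    linarith
  · convert heig using 1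
    rw [hε]
    push_cast
    ring

/-! ### Classical solutions, regularity and simplicity -/

/-- The continuous function on the circle given by a continuous `2π`-periodic function. -/
def periodicLift (f : ℝ → ℂ) (hp : Function.Periodic f (2 * Real.pi)) (hc : Continuous f) :
    C(Circ, ℂ) :=
  ⟨hp.lift, continuous_coinduced_dom.mpr hc⟩

theorem circle_coe_periodic (v : C(Circ, ℂ)) :
    Function.Periodic (fun θ : ℝ => v (θ : Circ)) (2 * Real.pi) := by
  intro θ
  simp only [AddCircle.coe_add_period]

theorem circle_coe_continuous (v : C(Circ, ℂ)) : Continuous (fun θ : ℝ => v (θ : Circ)) :=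
  v.continuous.comp (AddCircle.continuous_mk' _)

theorem circle_ext {v w : C(Circ, ℂ)} (h : ∀ θ : ℝ, v (θ : Circ) = w (θ : Circ)) : v = w := by
  ext x
  induction x using QuotientAddGroup.induction_on with
  | H x => exact h x

theorem circle_fourier_coe (n : ℤ) (x : ℝ) :
    (fourier n : C(Circ, ℂ)) (x : Circ) = Complex.exp (Complex.I * (n * x : ℂ)) := by
  rw [fourier_coe_apply]
  congr 1
  have : (Real.pi : ℂ) ≠ 0 := by exact_mod_cast Real.pi_ne_zero
  push_cast
  field_simp

theorem hasDerivAt_of_magneticDeriv {A : ℝ → ℝ} {f : ℝ → ℂ} (hf : Differentiable ℝ f) (θ : ℝ) :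
    HasDerivAt f (Complex.I * (magneticDeriv A f θ - A θ * f θ)) θ := by
  have h := (hf θ).hasDerivAt
  have e : Complex.I * (magneticDeriv A f θ - A θ * f θ) = deriv f θ := by
    rw [magneticDeriv]
    linear_combination -deriv f θ * Complex.I_sq
  rwa [e]

theorem magneticDeriv_eq_of_hasDerivAt {A : ℝ → ℝ} {f : ℝ → ℂ} {w : ℂ} {θ : ℝ}
    (h : HasDerivAt f (Complex.I * (w - A θ * f θ)) θ) : magneticDeriv A f θ = w := by
  simp only [magneticDeriv, h.deriv]
  linear_combination (A θ * f θ - w) * Complex.I_sq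

theorem hasDerivAt_exp_I_mul (a θ : ℝ) :
    HasDerivAt (fun x : ℝ => Complex.exp (Complex.I * (a * x : ℂ)))
      (Complex.I * a * Complex.exp (Complex.I * (a * θ : ℂ))) θ := by
  have h1 : HasDerivAt (fun x : ℝ => Complex.I * (a * x : ℂ)) (Complex.I * a) θ := by
    have := ((Complex.ofRealCLM.hasDerivAt (x := θ)).const_mul (a : ℂ)).const_mul Complex.I
    simpa using this
  have := h1.cexp
  rwa [mul_comm] at this

/-- Integration by parts over one period; the boundary terms cancel by periodicity. -/
theorem circleCoeff_magneticDeriv {δ : ℝ} {v w : C(Circ, ℂ)}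
    (hv : Differentiable ℝ (fun θ : ℝ => v (θ : Circ)))
    (hw : ∀ θ : ℝ, magneticDeriv (fun _ => δ) (fun θ : ℝ => v (θ : Circ)) θ = w (θ : Circ)) (n : ℤ) :
    circleCoeff n w = ((n : ℝ) + δ : ℝ) * circleCoeff n v := by
  have hco : ∀ u : C(Circ, ℂ), circleCoeff n u = (1 / (2 * Real.pi) : ℝ) *
      ∫ x in (0 : ℝ)..(2 * Real.pi),
        Complex.exp (Complex.I * (((-n : ℤ) : ℝ) * x : ℂ)) * u (x : Circ) := by
    intro u
    rw [circleCoeff_eq_fourierCoeff, fourierCoeff_eq_intervalIntegral u n 0, zero_add,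
      Complex.real_smul]
    congr 1
    refine intervalIntegral.integral_congr fun x _ => ?_
    simp only [smul_eq_mul]
    rw [circle_fourier_coe]
    push_cast
    rfl
  have hderiv : ∀ θ : ℝ, HasDerivAt
      (fun x : ℝ => Complex.exp (Complex.I * (((-n : ℤ) : ℝ) * x : ℂ)) * v (x : Circ))
      (Complex.I * (Complex.exp (Complex.I * (((-n : ℤ) : ℝ) * θ : ℂ)) * w (θ : Circ))
        - Complex.I * ((n : ℝ) + δ : ℝ) *
          (Complex.exp (Complex.I * (((-n : ℤ) : ℝ) * θ : ℂ)) * v (θ : Circ))) θ := by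
    intro θ
    have h1 := hasDerivAt_exp_I_mul ((-n : ℤ) : ℝ) θ
    have h2 := hasDerivAt_of_magneticDeriv (A := fun _ => δ) hv θ
    rw [hw θ] at h2
    refine (h1.mul h2).congr_deriv ?_
    push_cast
    ring
  have hce : Continuous fun x : ℝ => Complex.exp (Complex.I * (((-n : ℤ) : ℝ) * x : ℂ)) := by
    fun_prop
  have cw : Continuous fun x : ℝ => Complex.exp (Complex.I * (((-n : ℤ) : ℝ) * x : ℂ)) * w (x : Circ) :=
    hce.mul (circle_coe_continuous w)
  have cv : Continuous fun x : ℝ => Complex.exp (Complex.I * (((-n : ℤ) : ℝ) * x : ℂ)) * v (x : Circ) :=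
    hce.mul (circle_coe_continuous v)
  have hint := intervalIntegral.integral_eq_sub_of_hasDerivAt (a := 0) (b := 2 * Real.pi)
    (fun θ _ => hderiv θ)
    (((cw.const_mul Complex.I).sub (cv.const_mul _)).intervalIntegrable _ _)
  rw [intervalIntegral.integral_sub ((cw.const_mul _).intervalIntegrable _ _)
    ((cv.const_mul _).intervalIntegrable _ _), intervalIntegral.integral_const_mul,
    intervalIntegral.integral_const_mul] at hint
  have hper : Complex.exp (Complex.I * (((-n : ℤ) : ℝ) * (2 * Real.pi : ℝ) : ℂ))
      * v ((2 * Real.pi : ℝ) : Circ)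
      - Complex.exp (Complex.I * (((-n : ℤ) : ℝ) * (0 : ℝ) : ℂ)) * v ((0 : ℝ) : Circ) = 0 := by
    have e1 : ((2 * Real.pi : ℝ) : Circ) = ((0 : ℝ) : Circ) := by
      rw [AddCircle.coe_period]; rfl
    have e2 : Complex.exp (Complex.I * (((-n : ℤ) : ℝ) * (2 * Real.pi : ℝ) : ℂ)) = 1 := by
      rw [Complex.exp_eq_one_iff]
      exact ⟨-n, by push_cast; ring⟩
    rw [e1, e2]
    simp
  rw [hper] at hint
  rw [hco w, hco v]
  have hI := mul_left_cancel₀ Complex.I_ne_zero (by linear_combination hint :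
    Complex.I * (∫ x in (0 : ℝ)..(2 * Real.pi),
        Complex.exp (Complex.I * (((-n : ℤ) : ℝ) * x : ℂ)) * w (x : Circ))
      = Complex.I * (((n : ℝ) + δ : ℝ) * ∫ x in (0 : ℝ)..(2 * Real.pi),
        Complex.exp (Complex.I * (((-n : ℤ) : ℝ) * x : ℂ)) * v (x : Circ)))
  rw [hI]
  ring

theorem exp_two_pi_mul_ne_one {a : ℝ} (ha : ∀ m : ℤ, a ≠ m) :
    Complex.exp (Complex.I * (a * (2 * Real.pi : ℝ) : ℂ)) ≠ 1 := by
  intro h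
  rw [Complex.exp_eq_one_iff] at h
  obtain ⟨m, hm⟩ := h
  apply ha m
  have hpi : (Real.pi : ℂ) ≠ 0 := by exact_mod_cast Real.pi_ne_zero
  have : (a : ℂ) = m := by
    have h2 : (2 * Real.pi * Complex.I) * a = (2 * Real.pi * Complex.I) * (m : ℂ) := by
      push_cast at hm
      linear_combination hm
    exact mul_left_cancel₀ Complex.two_pi_I_ne_zero h2
  exact_mod_cast this

/-- The operator `-i d/dθ + δ` on the circle is onto when `δ` is not an integer. -/
theorem exists_magneticDeriv_eq {δ : ℝ} (hδ : ∀ m : ℤ, δ ≠ m) (w : C(Circ, ℂ)) :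
    ∃ v : C(Circ, ℂ), Differentiable ℝ (fun θ : ℝ => v (θ : Circ)) ∧
      ∀ θ : ℝ, magneticDeriv (fun _ => δ) (fun θ : ℝ => v (θ : Circ)) θ = w (θ : Circ) := by
  set E : ℝ → ℂ := fun x => Complex.exp (Complex.I * (δ * x : ℂ)) with hE
  have hEc : Continuous E := by fun_prop
  have hE0 : ∀ x, E x ≠ 0 := fun x => Complex.exp_ne_zero _
  have hEadd : ∀ x y, E (x + y) = E x * E y := by
    intro x y
    simp only [hE]
    rw [← Complex.exp_add]
    congr 1
    push_cast
    ring
  set F : ℝ → ℂ := fun s => E s * w (s : Circ) with hF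
  have hFc : Continuous F := hEc.mul (circle_coe_continuous w)
  set P : ℝ := 2 * Real.pi with hP
  have hE1 : E P - 1 ≠ 0 := sub_ne_zero.mpr (exp_two_pi_mul_ne_one hδ)
  have hFper : ∀ s, F (s + P) = E P * F s := by
    intro s
    simp only [hF]
    rw [hEadd, AddCircle.coe_add_period]
    ring
  set I0 : ℂ := ∫ s in (0 : ℝ)..P, F s with hI0
  -- Variation of constants gives a solution for every `c`; periodicity demands `c * (E P - 1) = i *
  -- I0`, solvable because `E P ≠ 1` for non-integer `δ`.
  set c : ℂ := Complex.I * I0 / (E P - 1) with hc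
  set f : ℝ → ℂ := fun x => (E x)⁻¹ * (c + Complex.I * ∫ s in (0 : ℝ)..x, F s) with hf
  have hii : ∀ a b, IntervalIntegrable F MeasureTheory.volume a b :=
    fun a b => hFc.intervalIntegrable a b
  have hshift : ∀ x, ∫ s in (0 : ℝ)..(x + P), F s = I0 + E P * ∫ s in (0 : ℝ)..x, F s := by
    intro x
    rw [← intervalIntegral.integral_add_adjacent_intervals (hii 0 P) (hii P (x + P))]
    congr 1
    have := intervalIntegral.integral_comp_add_right (a := 0) (b := x) F P
    rw [zero_add] at this
    rw [← this, ← intervalIntegral.integral_const_mul]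
    exact intervalIntegral.integral_congr fun s _ => hFper s
  have hper : Function.Periodic f P := by
    intro x
    simp only [hf]
    rw [hshift, hEadd]
    have h1 := hE0 x
    have h2 := hE0 P
    have h3 : c * E P = c + Complex.I * I0 := by
      rw [hc]; field_simp; ring
    field_simp
    linear_combination -h3
  have hEd : ∀ θ, HasDerivAt E (Complex.I * δ * E θ) θ := fun θ => hasDerivAt_exp_I_mul δ θ
  have hfd : ∀ θ : ℝ, HasDerivAt f (Complex.I * (w (θ : Circ) - δ * f θ)) θ := by
    intro θ
    have d1 := (hEd θ).inv (hE0 θ)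
    have d2 := ((hFc.integral_hasStrictDerivAt 0 θ).hasDerivAt.const_mul Complex.I).const_add c
    refine (d1.mul d2).congr_deriv ?_
    simp only [hf, hF, Pi.inv_apply]
    have h1 := hE0 θ
    field_simp
    ring
  have hfdiff : Differentiable ℝ f := fun θ => (hfd θ).differentiableAt
  refine ⟨periodicLift f hper hfdiff.continuous, hfdiff, fun θ => ?_⟩
  exact magneticDeriv_eq_of_hasDerivAt (A := fun _ => δ) (hfd θ)

/-- `v` is a classical solution of `(-i d/dθ + δ)² v + q v = t v` on the circle. -/
def IsCircleSolution (δ : ℝ) (q : C(Circ, ℂ)) (t : ℝ) (f : ℝ → ℂ) : Prop :=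
  Differentiable ℝ f ∧ Differentiable ℝ (magneticDeriv (fun _ => δ) f) ∧
  ∀ θ : ℝ, magneticDeriv (fun _ => δ) (magneticDeriv (fun _ => δ) f) θ + q (θ : Circ) * f θ
    = (t : ℂ) * f θ

theorem magneticDeriv_periodic {δ P : ℝ} {f : ℝ → ℂ} (hf : Function.Periodic f P) :
    Function.Periodic (magneticDeriv (fun _ => δ) f) P := by
  intro θ
  have h : deriv f (θ + P) = deriv f θ := by
    rw [← deriv_comp_add_const]
    congr 1
    exact funext hf
  simp only [magneticDeriv, h, hf θ]

/-- Elliptic regularity by inversion: solving the first order equation twice with right-hand side `t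
v - q v` gives a classical function with the same Fourier coefficients as `v`, since no `n + δ`
vanishes. The converse is two integrations by parts. -/
theorem isFourierEigen_iff {δ : ℝ} (hδ : ∀ m : ℤ, δ ≠ m) (q v : C(Circ, ℂ)) (t : ℝ) :
    IsFourierEigen δ q t v ↔ IsCircleSolution δ q t (fun θ : ℝ => v (θ : Circ)) := by
  constructor
  · intro h
    obtain ⟨w1, d1, e1⟩ := exists_magneticDeriv_eq hδ ((t : ℂ) • v - q * v)
    obtain ⟨w2, d2, e2⟩ := exists_magneticDeriv_eq hδ w1
    have hw : v = w2 := by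
      refine eq_of_circleCoeff_eq fun n => ?_
      have hn : (((n : ℝ) + δ : ℝ) : ℂ) ≠ 0 := by
        have : (n : ℝ) + δ ≠ 0 := fun h0 => hδ (-n) (by push_cast; linarith)
        exact_mod_cast this
      have c1 := circleCoeff_magneticDeriv d1 e1 n
      have c2 := circleCoeff_magneticDeriv d2 e2 n
      have c3 := h n
      rw [map_sub, map_smul, smul_eq_mul, ← c3, c2] at c1
      have c4 : (((n : ℝ) + δ : ℝ) : ℂ) * ((((n : ℝ) + δ : ℝ) : ℂ) * circleCoeff n v)
          = (((n : ℝ) + δ : ℝ) : ℂ) * ((((n : ℝ) + δ : ℝ) : ℂ) * circleCoeff n w2) := by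
        rw [← c1]; push_cast; ring
      exact mul_left_cancel₀ hn (mul_left_cancel₀ hn c4)
    rw [← hw] at d2 e2
    have e2' : magneticDeriv (fun _ => δ) (fun θ : ℝ => v (θ : Circ))
        = fun θ : ℝ => w1 (θ : Circ) := funext e2
    refine ⟨d2, by rw [e2']; exact d1, fun θ => ?_⟩
    rw [e2', e1]
    simp
  · rintro ⟨d1, d2, e⟩ n
    have hp := magneticDeriv_periodic (δ := δ) (circle_coe_periodic v)
    set w : C(Circ, ℂ) := periodicLift _ hp d2.continuous
    have c1 := circleCoeff_magneticDeriv (δ := δ) (v := v) (w := w) d1 (fun θ => rfl) n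
    have c2 := circleCoeff_magneticDeriv (δ := δ) (v := w) (w := (t : ℂ) • v - q * v) d2
      (fun θ => ?_) n
    · rw [map_sub, map_smul, smul_eq_mul, c1] at c2
      rw [c2]; push_cast; ring
    · have := e θ
      simp only [ContinuousMap.sub_apply, ContinuousMap.smul_apply, ContinuousMap.mul_apply,
        smul_eq_mul]
      rw [← this]
      exact (add_sub_cancel_right _ _).symm

/-- A solution with vanishing Cauchy data is zero. -/
theorem IsCircleSolution.eq_zero {δ t : ℝ} {q : C(Circ, ℂ)} {f : ℝ → ℂ}
    (h : IsCircleSolution δ q t f) (hp : Function.Periodic f (2 * Real.pi)) {x : ℝ} (h0 : f x = 0)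
    (h1 : magneticDeriv (fun _ => δ) f x = 0) (y : ℝ) : f y = 0 := by
  obtain ⟨d1, d2, e⟩ := h
  set g := magneticDeriv (fun _ => δ) f with hg
  set K : ℝ := |t| + ‖q‖ + |δ| + 1 with hK
  have hδ0 := abs_nonneg δ
  have ht0 := abs_nonneg t
  have hq0 := norm_nonneg q
  have hd : ∀ θ, HasDerivAt (fun θ => (f θ, g θ))
      (Complex.I * (g θ - δ * f θ), Complex.I * (t * f θ - q (θ : Circ) * f θ - δ * g θ)) θ := by
    intro θ
    have a1 := hasDerivAt_of_magneticDeriv (A := fun _ => δ) d1 θ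
    have a2 := hasDerivAt_of_magneticDeriv (A := fun _ => δ) d2 θ
    have a3 : magneticDeriv (fun _ => δ) g θ = t * f θ - q (θ : Circ) * f θ := by
      rw [← e θ]; ring
    rw [a3] at a2
    exact a1.prodMk a2
  -- Grönwall for the first order system satisfied by `(f, g)`, on one period to the right of `x`;
  -- periodicity reaches every other point.
  have key := eq_zero_of_abs_deriv_le_mul_abs_self_of_eq_zero_right (K := K) (a := x)
    (b := x + 2 * Real.pi) (f := fun θ => (f θ, g θ))
    (fun θ _ => (hd θ).continuousAt.continuousWithinAt) (fun θ _ => (hd θ).hasDerivWithinAt)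
    (by simp [h0, h1]) (fun θ _ => ?_)
  · obtain ⟨z, hz, hzy⟩ := hp.exists_mem_Ico Real.two_pi_pos y x
    rw [hzy]
    exact (Prod.mk.inj (key z (Set.Ico_subset_Icc_self hz))).1
  · have n1 : ‖f θ‖ ≤ ‖(f θ, g θ)‖ := norm_fst_le (f θ, g θ)
    have n2 : ‖g θ‖ ≤ ‖(f θ, g θ)‖ := norm_snd_le (f θ, g θ)
    set X := ‖(f θ, g θ)‖
    have hX : 0 ≤ X := (norm_nonneg _).trans n1
    have b1 : ‖(δ : ℂ) * f θ‖ ≤ |δ| * X := by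
      rw [norm_mul, Complex.norm_real, Real.norm_eq_abs]; gcongr
    have b2 : ‖(δ : ℂ) * g θ‖ ≤ |δ| * X := by
      rw [norm_mul, Complex.norm_real, Real.norm_eq_abs]; gcongr
    have b3 : ‖(t : ℂ) * f θ‖ ≤ |t| * X := by
      rw [norm_mul, Complex.norm_real, Real.norm_eq_abs]; gcongr
    have b4 : ‖q (θ : Circ) * f θ‖ ≤ ‖q‖ * X := by
      rw [norm_mul]
      exact mul_le_mul (q.norm_coe_le_norm _) n1 (norm_nonneg _) hq0
    refine max_le ?_ ?_
    · rw [norm_mul, Complex.norm_I, one_mul]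
      refine (norm_sub_le _ _).trans ?_
      nlinarith [mul_nonneg ht0 hX, mul_nonneg hq0 hX]
    · rw [norm_mul, Complex.norm_I, one_mul]
      have c1 := norm_sub_le ((t : ℂ) * f θ - q (θ : Circ) * f θ) (δ * g θ)
      have c2 := norm_sub_le ((t : ℂ) * f θ) (q (θ : Circ) * f θ)
      nlinarith

/-- All eigenvalues are simple when `2δ` is not an integer. -/
theorem IsCircleSolution.exists_eq_smul {δ t : ℝ} (hδ : ∀ m : ℤ, 2 * δ ≠ m) {q v w : C(Circ, ℂ)}
    (hv : IsCircleSolution δ q t (fun θ : ℝ => v (θ : Circ)))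
    (hw : IsCircleSolution δ q t (fun θ : ℝ => w (θ : Circ))) (h0 : v ≠ 0) :
    ∃ c : ℂ, w = c • v := by
  obtain ⟨x, hx⟩ : ∃ x : ℝ, v (x : Circ) ≠ 0 := by
    by_contra! hcon
    exact h0 (circle_ext hcon)
  set f : ℝ → ℂ := fun θ => v (θ : Circ) with hf
  set g : ℝ → ℂ := fun θ => w (θ : Circ) with hg
  set Df := magneticDeriv (fun _ => δ) f with hDf
  set Dg := magneticDeriv (fun _ => δ) g with hDg
  have pf : Function.Periodic f (2 * Real.pi) := circle_coe_periodic v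
  have pg : Function.Periodic g (2 * Real.pi) := circle_coe_periodic w
  have pDf : Function.Periodic Df (2 * Real.pi) := magneticDeriv_periodic pf
  have pDg : Function.Periodic Dg (2 * Real.pi) := magneticDeriv_periodic pg
  set E : ℝ → ℂ := fun θ => Complex.exp (Complex.I * ((2 * δ : ℝ) * θ : ℂ)) with hE
  -- For `D = -i d/dθ + δ` the Wronskian `f Dg - g Df` satisfies `W' = -2iδ W`, so `exp (2iδθ) W` is
  -- constant. As `W` is periodic and `exp (4πiδ) ≠ 1`, it vanishes.
  have hW : ∀ θ, HasDerivAt (fun θ => E θ * (f θ * Dg θ - g θ * Df θ)) 0 θ := by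
    intro θ
    have a1 := hasDerivAt_of_magneticDeriv (A := fun _ => δ) hv.1 θ
    have a2 := hasDerivAt_of_magneticDeriv (A := fun _ => δ) hv.2.1 θ
    have b1 := hasDerivAt_of_magneticDeriv (A := fun _ => δ) hw.1 θ
    have b2 := hasDerivAt_of_magneticDeriv (A := fun _ => δ) hw.2.1 θ
    have d := (hasDerivAt_exp_I_mul (2 * δ) θ).mul ((a1.mul b2).sub (b1.mul a2))
    refine d.congr_deriv ?_
    have e1 := hv.2.2 θ
    have e2 := hw.2.2 θ
    simp only [Pi.sub_apply, Pi.mul_apply]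
    push_cast
    linear_combination (Complex.I * Complex.exp (Complex.I * (2 * δ * θ : ℂ)) * f θ) * e2
      - (Complex.I * Complex.exp (Complex.I * (2 * δ * θ : ℂ)) * g θ) * e1
  have hconst := is_const_of_deriv_eq_zero (fun θ => (hW θ).differentiableAt)
    (fun θ => (hW θ).deriv)
  have hE1 : E (2 * Real.pi) - 1 ≠ 0 := sub_ne_zero.mpr (exp_two_pi_mul_ne_one hδ)
  have hE0 : E 0 = 1 := by simp [hE]
  have hzero : f 0 * Dg 0 - g 0 * Df 0 = 0 := by
    have := hconst (2 * Real.pi) 0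
    have q1 := pf 0
    have q2 := pg 0
    have q3 := pDf 0
    have q4 := pDg 0
    rw [zero_add] at q1 q2 q3 q4
    rw [q1, q2, q3, q4, hE0] at this
    have h2 : (E (2 * Real.pi) - 1) * (f 0 * Dg 0 - g 0 * Df 0) = 0 := by linear_combination this
    exact (mul_eq_zero.mp h2).resolve_left hE1
  have hall : f x * Dg x - g x * Df x = 0 := by
    have := hconst x 0
    rw [hzero, mul_zero] at this
    exact (mul_eq_zero.mp this).resolve_left (Complex.exp_ne_zero _)
  set c : ℂ := g x / f x with hc
  have hcx : g x = c * f x := by rw [hc, div_mul_cancel₀ _ hx]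
  -- The combination `w - c v` solves the equation, vanishes at `x` by the choice of `c`, and has
  -- zero magnetic derivative there because the Wronskian is zero.
  have hsol : IsCircleSolution δ q t (fun θ => g θ + (-c) * f θ) := by
    have m0 := magneticDeriv_mul (A := fun _ => δ) (-c) hv.1
    have m1 : magneticDeriv (fun _ => δ) (fun θ => g θ + (-c) * f θ)
        = fun θ => Dg θ + (-c) * Df θ := by
      rw [magneticDeriv_add hw.1 (hv.1.const_mul _), m0]
    refine ⟨hw.1.add (hv.1.const_mul _), ?_, fun θ => ?_⟩
    · rw [m1]; exact hw.2.1.add (hv.2.1.const_mul _)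
    · rw [m1, magneticDeriv_add hw.2.1 (hv.2.1.const_mul _), magneticDeriv_mul (-c) hv.2.1]
      linear_combination hw.2.2 θ - c * hv.2.2 θ
  have hp : Function.Periodic (fun θ => g θ + (-c) * f θ) (2 * Real.pi) := by
    intro θ
    simp only [pf θ, pg θ]
  have hD : magneticDeriv (fun _ => δ) (fun θ => g θ + (-c) * f θ) x = 0 := by
    rw [magneticDeriv_add hw.1 (hv.1.const_mul _), magneticDeriv_mul (-c) hv.1]
    have : f x * (Dg x + (-c) * Df x) = 0 := by
      linear_combination hall + Df x * hcx
    exact (mul_eq_zero.mp this).resolve_left hx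
  refine ⟨c, circle_ext fun θ => ?_⟩
  have := hsol.eq_zero hp (x := x) (by rw [hcx]; ring) hD θ
  simp only [ContinuousMap.smul_apply, smul_eq_mul]
  linear_combination this

/-! ### Parametrization of the circle and gauge transformation -/

theorem pt_periodic : Function.Periodic pt (2 * Real.pi) := by
  intro θ
  simp [pt]

theorem dist_pt_le (s t : ℝ) : dist (pt s) (pt t) ≤ |s - t| := by
  rw [Subtype.dist_eq, EuclideanSpace.dist_eq]
  apply Real.sqrt_le_iff.mpr ⟨abs_nonneg _, ?_⟩
  simp only [pt, Fin.sum_univ_two, Real.dist_eq, sq_abs]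
  have h := Real.one_sub_sq_div_two_le_cos (x := s - t)
  rw [Real.cos_sub] at h
  simp
  nlinarith [Real.sin_sq_add_cos_sq s, Real.sin_sq_add_cos_sq t]

theorem pt_continuous : Continuous pt := by
  have : LipschitzWith 1 pt := LipschitzWith.of_dist_le_mul fun s t => by
    simpa [Real.dist_eq] using dist_pt_le s t
  exact this.continuous

theorem tangent_continuous : Continuous tangent := by
  unfold tangent
  refine (PiLp.continuous_toLp 2 _).comp (continuous_pi fun i => ?_)
  fin_cases i
  · exact Real.continuous_sin.neg
  · exact Real.continuous_cos

theorem tangent_periodic : Function.Periodic tangent (2 * Real.pi) := by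
  intro θ
  simp [tangent]

theorem pt_surjective : Function.Surjective pt := by
  intro ω
  have hω : ‖(ω : Plane)‖ = 1 := by simp
  have h1 : (ω : Plane) 0 ^ 2 + (ω : Plane) 1 ^ 2 = 1 := by
    rw [EuclideanSpace.norm_eq, Real.sqrt_eq_one] at hω
    simpa [Fin.sum_univ_two] using hω
  set z : ℂ := ⟨(ω : Plane) 0, (ω : Plane) 1⟩ with hz
  have hz1 : ‖z‖ = 1 := by
    rw [Complex.norm_def, Complex.normSq_apply, Real.sqrt_eq_one]
    simp only [hz]
    linarith
  have hz0 : z ≠ 0 := by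
    intro h
    rw [h, norm_zero] at hz1
    exact zero_ne_one hz1
  refine ⟨Complex.arg z, Subtype.ext ?_⟩
  ext i
  fin_cases i
  · have : Real.cos (Complex.arg z) = (ω : Plane) 0 := by rw [Complex.cos_arg hz0, hz1, div_one]
    simpa [pt] using this
  · have : Real.sin (Complex.arg z) = (ω : Plane) 1 := by rw [Complex.sin_arg, hz1, div_one]
    simpa [pt] using this

theorem exists_int_of_pt_eq {s t : ℝ} (h : pt s = pt t) : ∃ n : ℤ, s = t + n * (2 * Real.pi) := by
  have h1 := congrArg (fun ω : UnitCircle => (ω : Plane) 0) h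
  have h2 := congrArg (fun ω : UnitCircle => (ω : Plane) 1) h
  simp only [pt] at h1 h2
  have h3 := Real.Angle.cos_sin_inj (by simpa using h1) (by simpa using h2)
  obtain ⟨n, hn⟩ := Real.Angle.angle_eq_iff_two_pi_dvd_sub.mp h3
  exact ⟨n, by linarith⟩

/-- Periodic functions are functions on the unit circle. -/
theorem Function.Periodic.exists_comp_pt {α : Type*} {f : ℝ → α}
    (hf : Function.Periodic f (2 * Real.pi)) : ∃ ψ : UnitCircle → α, ∀ θ, ψ (pt θ) = f θ := by
  choose ang hang using pt_surjective
  refine ⟨fun ω => f (ang ω), fun θ => ?_⟩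
  obtain ⟨n, hn⟩ := exists_int_of_pt_eq (hang (pt θ))
  change f (ang (pt θ)) = f θ
  rw [hn]
  exact hf.int_mul n θ

theorem angularComponent_continuous {Avec : UnitCircle → Plane} (h : Continuous Avec) :
    Continuous (angularComponent Avec) :=
  (h.comp pt_continuous).inner tangent_continuous

theorem angularComponent_periodic (Avec : UnitCircle → Plane) :
    Function.Periodic (angularComponent Avec) (2 * Real.pi) := by
  intro θ
  simp only [angularComponent, pt_periodic θ, tangent_periodic θ]

/-- The unimodular factor turning the field `A` into the constant field `δ`. -/
def gaugeFactor (A : ℝ → ℝ) (δ θ : ℝ) : ℂ :=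
  Complex.exp (-Complex.I * (((∫ t in (0 : ℝ)..θ, A t) - δ * θ : ℝ) : ℂ))

theorem gaugeFactor_ne_zero (A : ℝ → ℝ) (δ θ : ℝ) : gaugeFactor A δ θ ≠ 0 := Complex.exp_ne_zero _

theorem norm_gaugeFactor (A : ℝ → ℝ) (δ θ : ℝ) : ‖gaugeFactor A δ θ‖ = 1 := by
  rw [gaugeFactor, Complex.norm_exp]
  simp

theorem hasDerivAt_gaugeFactor {A : ℝ → ℝ} (hA : Continuous A) (δ θ : ℝ) :
    HasDerivAt (gaugeFactor A δ) (-Complex.I * (A θ - δ : ℝ) * gaugeFactor A δ θ) θ := by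
  have h1 : HasDerivAt (fun θ : ℝ => (∫ t in (0 : ℝ)..θ, A t) - δ * θ) (A θ - δ) θ := by
    refine ((hA.integral_hasStrictDerivAt 0 θ).hasDerivAt.fun_sub
      ((hasDerivAt_id θ).const_mul δ)).congr_deriv ?_
    rw [mul_one]
  have h2 := (h1.ofReal_comp.const_mul (-Complex.I)).cexp
  refine h2.congr_deriv ?_
  rw [gaugeFactor]
  ring

/-- Over one period the phase changes by `2π (average A - δ) = 2π m`. -/
theorem gaugeFactor_periodic {A : ℝ → ℝ} (hA : Continuous A) (hp : Function.Periodic A (2 * Real.pi))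
    {δ : ℝ} {m : ℤ} (hm : average A = δ + m) : Function.Periodic (gaugeFactor A δ) (2 * Real.pi) := by
  intro θ
  have h1 : ∫ t in (0 : ℝ)..(θ + 2 * Real.pi), A t
      = (∫ t in (0 : ℝ)..θ, A t) + 2 * Real.pi * (δ + m) := by
    rw [← intervalIntegral.integral_add_adjacent_intervals (hA.intervalIntegrable 0 θ)
      (hA.intervalIntegrable θ _), hp.intervalIntegral_add_eq θ 0, zero_add, ← hm, average]
    field_simp
  rw [gaugeFactor, h1, gaugeFactor, Complex.exp_eq_exp_iff_exists_int]
  refine ⟨-m, ?_⟩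
  push_cast
  ring

theorem magneticDeriv_gaugeFactor {A : ℝ → ℝ} (hA : Continuous A) (δ : ℝ) {f : ℝ → ℂ}
    (hf : Differentiable ℝ f) :
    magneticDeriv A (fun θ => gaugeFactor A δ θ * f θ)
      = fun θ => gaugeFactor A δ θ * magneticDeriv (fun _ => δ) f θ := by
  funext θ
  refine magneticDeriv_eq_of_hasDerivAt ?_
  refine ((hasDerivAt_gaugeFactor hA δ θ).mul
    (hasDerivAt_of_magneticDeriv (A := fun _ => δ) hf θ)).congr_deriv ?_
  push_cast
  ring

theorem gaugeFactor_mul_differentiable_iff {A : ℝ → ℝ} (hA : Continuous A) (δ : ℝ) {f : ℝ → ℂ} :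
    Differentiable ℝ (fun θ => gaugeFactor A δ θ * f θ) ↔ Differentiable ℝ f := by
  have hg : Differentiable ℝ (gaugeFactor A δ) := fun θ => (hasDerivAt_gaugeFactor hA δ θ).differentiableAt
  constructor
  · intro h
    have e : ((gaugeFactor A δ)⁻¹ * fun θ => gaugeFactor A δ θ * f θ) = f :=
      funext fun θ => inv_mul_cancel_left₀ (gaugeFactor_ne_zero A δ θ) (f θ)
    rw [← e]
    exact (hg.inv (gaugeFactor_ne_zero A δ)).mul h
  · exact fun h => hg.mul h

/-- The potential as a continuous function on `ℝ / 2πℤ`. -/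
def circlePotential (a : UnitCircle → ℝ) (ha : Continuous a) : C(Circ, ℂ) :=
  periodicLift (fun θ => (a (pt θ) : ℂ)) (fun θ => by simp only [pt_periodic θ])
    (Complex.continuous_ofReal.comp (ha.comp pt_continuous))

theorem circlePotential_coe {a : UnitCircle → ℝ} (ha : Continuous a) (θ : ℝ) :
    circlePotential a ha (θ : Circ) = (a (pt θ) : ℂ) := rfl

theorem star_circlePotential {a : UnitCircle → ℝ} (ha : Continuous a) :
    star (circlePotential a ha) = circlePotential a ha := by
  refine circle_ext fun θ => ?_
  rw [ContinuousMap.star_apply, circlePotential_coe]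
  simp

theorem circleCoeff_zero_circlePotential {a : UnitCircle → ℝ} (ha : Continuous a) :
    circleCoeff 0 (circlePotential a ha) = (avga a : ℂ) := by
  rw [circleCoeff_eq_fourierCoeff, fourierCoeff_eq_intervalIntegral _ 0 0, zero_add,
    Complex.real_smul, avga, average]
  push_cast
  rw [← intervalIntegral.integral_ofReal]
  simp only [neg_zero, fourier_zero, one_smul, circlePotential_coe]

theorem exists_circleCoeff_circlePotential_le {a : UnitCircle → ℝ} (hl : ∃ C, LipschitzWith C a)
    (ha : Continuous a) : ∃ B : ℝ, ∀ m : ℤ, |(m : ℝ)| * ‖circleCoeff m (circlePotential a ha)‖ ≤ B := by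
  obtain ⟨C, hC⟩ := hl
  refine ⟨C * Real.pi, norm_circleCoeff_mul_le_of_lipschitz fun s t => ?_⟩
  rw [circlePotential_coe, circlePotential_coe, ← Complex.ofReal_sub, Complex.norm_real,
    ← dist_eq_norm]
  exact (hC.dist_le_mul _ _).trans (mul_le_mul_of_nonneg_left (dist_pt_le s t) C.coe_nonneg)

section

variable {Avec : UnitCircle → Plane} {a : UnitCircle → ℝ} {δ : ℝ}

theorem solvesEigenEq_iff (hA : Continuous Avec) (ha : Continuous a) {t : ℝ}
    {ψ : UnitCircle → ℂ} {f : ℝ → ℂ}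
    (h : ∀ θ, ψ (pt θ) = gaugeFactor (angularComponent Avec) δ θ * f θ) :
    SolvesEigenEq Avec a t ψ ↔ IsCircleSolution δ (circlePotential a ha) t f := by
  have hA' := angularComponent_continuous hA
  have h' : (fun θ => ψ (pt θ)) = fun θ => gaugeFactor (angularComponent Avec) δ θ * f θ := funext h
  unfold SolvesEigenEq IsCircleSolution
  rw [h', gaugeFactor_mul_differentiable_iff hA']
  refine and_congr_right fun d1 => ?_
  rw [magneticDeriv_gaugeFactor hA' δ d1, gaugeFactor_mul_differentiable_iff hA']
  refine and_congr_right fun d2 => forall_congr' fun θ => ?_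
  rw [magneticDeriv_gaugeFactor hA' δ d2, h, circlePotential_coe]
  have hg := gaugeFactor_ne_zero (angularComponent Avec) δ θ
  constructor
  · intro e
    apply mul_left_cancel₀ hg
    linear_combination e
  · intro e
    linear_combination gaugeFactor (angularComponent Avec) δ θ * e

theorem mem_eigenspaceL_iff (hA : Continuous Avec) (ha : Continuous a) {m : ℤ}
    (hm : avgA Avec = δ + m) (hδ : ∀ n : ℤ, δ ≠ n) {t : ℝ} {ψ : UnitCircle → ℂ} :
    ψ ∈ eigenspaceL Avec a t ↔ ∃ v : C(Circ, ℂ), IsFourierEigen δ (circlePotential a ha) t v ∧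
      ∀ θ : ℝ, ψ (pt θ) = gaugeFactor (angularComponent Avec) δ θ * v (θ : Circ) := by
  have hA' := angularComponent_continuous hA
  have hgp := gaugeFactor_periodic hA' (angularComponent_periodic Avec) hm
  constructor
  · intro (hψ : SolvesEigenEq Avec a t ψ)
    set f : ℝ → ℂ := fun θ => (gaugeFactor (angularComponent Avec) δ θ)⁻¹ * ψ (pt θ) with hf
    have hfψ : ∀ θ, ψ (pt θ) = gaugeFactor (angularComponent Avec) δ θ * f θ := by
      intro θ
      rw [hf, mul_inv_cancel_left₀ (gaugeFactor_ne_zero _ _ _)]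
    have hs := (solvesEigenEq_iff (δ := δ) hA ha hfψ).mp hψ
    have hp : Function.Periodic f (2 * Real.pi) := by
      intro θ
      simp only [hf, hgp θ, pt_periodic θ]
    exact ⟨periodicLift f hp hs.1.continuous, (isFourierEigen_iff hδ _ _ t).mpr hs, hfψ⟩
  · rintro ⟨v, hv, hψ⟩
    exact (solvesEigenEq_iff (δ := δ) hA ha hψ).mpr ((isFourierEigen_iff hδ _ _ t).mp hv)

theorem exists_eq_gaugeFactor_mul (hA : Continuous Avec) {m : ℤ}
    (hm : avgA Avec = δ + m) (v : C(Circ, ℂ)) :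
    ∃ ψ : UnitCircle → ℂ, ∀ θ : ℝ, ψ (pt θ) = gaugeFactor (angularComponent Avec) δ θ * v (θ : Circ) := by
  have hgp := gaugeFactor_periodic (angularComponent_continuous hA) (angularComponent_periodic Avec) hm
  refine Function.Periodic.exists_comp_pt fun θ => ?_
  rw [hgp θ, AddCircle.coe_add_period]

/-- The gauge factor is unimodular; `2π` is the ratio of `dθ` to the normalized Haar measure. -/
theorem integral_norm_sq_comp_pt {ψ : UnitCircle → ℂ} {v : C(Circ, ℂ)}
    (h : ∀ θ : ℝ, ψ (pt θ) = gaugeFactor (angularComponent Avec) δ θ * v (θ : Circ)) :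
    ∫ θ in (0 : ℝ)..(2 * Real.pi), ‖ψ (pt θ)‖ ^ 2 = 2 * Real.pi * ‖circleL2 v‖ ^ 2 := by
  have h1 : ∀ θ : ℝ, ‖ψ (pt θ)‖ ^ 2 = ‖v (θ : Circ)‖ ^ 2 := by
    intro θ
    rw [h, norm_mul, norm_gaugeFactor, one_mul]
  simp only [h1]
  have h2 := AddCircle.intervalIntegral_preimage (2 * Real.pi) 0 (fun x : Circ => ‖v x‖ ^ 2)
  rw [zero_add] at h2
  rw [h2, norm_sq_circleL2, AddCircle.integral_haarAddCircle]
  have := Real.pi_ne_zero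
  simp
  field_simp

/-- The eigenspaces are at most one-dimensional, and nonzero exactly on the Fourier spectrum. -/
theorem finite_and_finrank_eigenspaceL (hA : Continuous Avec) (ha : Continuous a) {m : ℤ}
    (hm : avgA Avec = δ + m) (hδ : ∀ n : ℤ, 2 * δ ≠ n) (t : ℝ) :
    Module.Finite ℂ (eigenspaceL Avec a t) ∧
      (t ∈ fourierSpectrum δ (circlePotential a ha) → Module.finrank ℂ (eigenspaceL Avec a t) = 1) ∧
      (t ∉ fourierSpectrum δ (circlePotential a ha) → Module.finrank ℂ (eigenspaceL Avec a t) = 0) := by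
  have hδ' : ∀ n : ℤ, δ ≠ n := fun n h => hδ (2 * n) (by rw [h]; push_cast; ring)
  by_cases ht : t ∈ fourierSpectrum δ (circlePotential a ha)
  · obtain ⟨v, h0, hv⟩ := ht
    obtain ⟨ψ, hψ⟩ := exists_eq_gaugeFactor_mul hA hm v
    have hspan : eigenspaceL Avec a t = Submodule.span ℂ {ψ} := by
      ext φ
      rw [mem_eigenspaceL_iff hA ha hm hδ', Submodule.mem_span_singleton]
      constructor
      · rintro ⟨w, hw, hφ⟩
        obtain ⟨c, rfl⟩ := IsCircleSolution.exists_eq_smul hδ ((isFourierEigen_iff hδ' _ _ t).mp hv)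
          ((isFourierEigen_iff hδ' _ _ t).mp hw) h0
        refine ⟨c, funext fun ω => ?_⟩
        obtain ⟨θ, rfl⟩ := pt_surjective ω
        rw [Pi.smul_apply, hψ, hφ]
        simp only [ContinuousMap.smul_apply, smul_eq_mul]
        ring
      · rintro ⟨c, rfl⟩
        refine ⟨c • v, hv.smul c, fun θ => ?_⟩
        rw [Pi.smul_apply, hψ]
        simp only [ContinuousMap.smul_apply, smul_eq_mul]
        ring
    have hψ0 : ψ ≠ 0 := by
      rintro rfl
      refine h0 (circle_ext fun θ => ?_)
      have := hψ θ
      rw [Pi.zero_apply, eq_comm] at this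
      exact (mul_eq_zero.mp this).resolve_left (gaugeFactor_ne_zero _ _ _)
    rw [hspan]
    exact ⟨inferInstance, fun _ => finrank_span_singleton hψ0, fun h => absurd ⟨v, h0, hv⟩ h⟩
  · have hbot : eigenspaceL Avec a t = ⊥ := by
      rw [Submodule.eq_bot_iff]
      intro φ hφ
      obtain ⟨w, hw, hφ⟩ := (mem_eigenspaceL_iff hA ha hm hδ').mp hφ
      have hw0 : w = 0 := by
        by_contra h0
        exact ht ⟨w, h0, hw⟩
      funext ω
      obtain ⟨θ, rfl⟩ := pt_surjective ω
      rw [hφ, hw0]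
      simp
    rw [hbot]
    exact ⟨inferInstance, fun h => absurd h ht, fun _ => finrank_bot ℂ _⟩

end

/-! ### Enumeration and asymptotics of the large eigenvalues -/

/-- An infinite set of reals which is finite below every bound can be enumerated increasingly. -/
theorem exists_strictMono_range_eq {S : Set ℝ} (hinf : S.Infinite)
    (hfin : ∀ T, (S ∩ Set.Iic T).Finite) :
    ∃ μ : ℕ → ℝ, StrictMono μ ∧ Set.range μ = S ∧ Tendsto μ atTop atTop := by
  have hlarge : ∀ T, ∃ s ∈ S, T < s := by
    intro T
    by_contra! h
    exact hinf ((hfin T).subset fun s hs => ⟨hs, h s hs⟩)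
  obtain ⟨s0, hs0, -⟩ := hlarge 0
  obtain ⟨b, hb, hbmin⟩ := Set.exists_min_image _ id (hfin s0) ⟨s0, hs0, le_refl s0⟩
  have hbot : ∀ s ∈ S, b ≤ s := by
    intro s hs
    rcases le_total s s0 with h | h
    · exact hbmin s ⟨hs, h⟩
    · exact hb.2.trans h
  -- A locally finite linear order with a least and no greatest element is isomorphic to `ℕ`.
  let _ : LocallyFiniteOrder S := LocallyFiniteOrder.ofFiniteIcc fun x y => by
    refine Set.Finite.of_finite_image (f := Subtype.val) ((hfin y).subset ?_)
      Subtype.val_injective.injOn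
    rintro _ ⟨z, hz, rfl⟩
    exact ⟨z.2, hz.2⟩
  let _ : SuccOrder S := LinearLocallyFiniteOrder.succOrder S
  let _ : PredOrder S := LinearLocallyFiniteOrder.predOrder S
  let _ : OrderBot S := { bot := ⟨b, hb.1⟩, bot_le := fun s => hbot s s.2 }
  have : NoMaxOrder S := ⟨fun s => by
    obtain ⟨t, ht, hst⟩ := hlarge s
    exact ⟨⟨t, ht⟩, hst⟩⟩
  let e : S ≃o ℕ := orderIsoNatOfLinearSuccPredArch
  have hmono : StrictMono (fun n => (e.symm n : ℝ)) := fun x y hxy => e.symm.strictMono hxy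
  refine ⟨fun n => (e.symm n : ℝ), hmono, ?_, ?_⟩
  · ext s
    constructor
    · rintro ⟨n, rfl⟩
      exact (e.symm n).2
    · intro hs
      exact ⟨e ⟨s, hs⟩, by simp⟩
  · refine tendsto_atTop_atTop_of_monotone hmono.monotone fun T => ?_
    obtain ⟨s, hs, hT⟩ := hlarge T
    exact ⟨e ⟨s, hs⟩, by simpa using hT.le⟩

theorem eventually_cofinite_le_abs (ℓ : ℕ) : ∀ᶠ j : ℤ in cofinite, (ℓ : ℤ) ≤ |j| := by
  refine (Set.finite_Icc (-(ℓ : ℤ)) ℓ).subset fun j hj => ?_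
  simp only [Set.mem_compl_iff, Set.mem_ofPred_eq, not_le] at hj
  rw [Set.mem_Icc, ← abs_le]
  exact hj.le

/-- Factor `ε = (s - x)(s + x)` with `s` the root. If `x² + ε ≤ 0` the root is zero by convention,
and `x² ≤ -ε` suffices. -/
theorem abs_sqrt_sub_mul_le {x ε : ℝ} (hx : 0 ≤ x) : |√(x ^ 2 + ε) - x| * x ≤ |ε| := by
  rcases le_total 0 (x ^ 2 + ε) with h | h
  · have h1 := Real.sq_sqrt h
    have h0 := Real.sqrt_nonneg (x ^ 2 + ε)
    set s := √(x ^ 2 + ε)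
    have h2 : |s - x| * (s + x) = |ε| := by
      have e : ε = (s - x) * (s + x) := by linear_combination -h1
      rw [e, abs_mul, abs_of_nonneg (add_nonneg h0 hx)]
    rw [← h2]
    exact mul_le_mul_of_nonneg_left (by linarith) (abs_nonneg _)
  · rw [Real.sqrt_eq_zero_of_nonpos h, zero_sub, abs_neg, abs_of_nonneg hx]
    have := neg_abs_le ε
    nlinarith

theorem sign_mul_add_abs_eq {δ : ℝ} (hδ : |δ| ≤ 1 / 2) {j : ℤ} (hj : j ≠ 0) :
    (Int.sign j : ℝ) * δ + |(j : ℝ)| = |(j : ℝ) + δ| := by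
  have h := abs_le.mp hδ
  rcases lt_or_gt_of_ne hj with h0 | h0
  · have h1 : (j : ℝ) ≤ -1 := by exact_mod_cast (by omega : j ≤ -1)
    rw [Int.sign_eq_neg_one_of_neg h0, abs_of_neg (by linarith : (j : ℝ) < 0),
      abs_of_neg (by linarith : (j : ℝ) + δ < 0)]
    push_cast
    ring
  · have h1 : (1 : ℝ) ≤ j := by exact_mod_cast (by omega : 1 ≤ j)
    rw [Int.sign_eq_one_of_pos h0, abs_of_pos (by linarith : (0 : ℝ) < j),
      abs_of_pos (by linarith : 0 < (j : ℝ) + δ)]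
    push_cast
    ring

/-- Description of the large eigenvalues of `(-i d/dθ + δ)² + q` on the circle. -/
theorem exists_large_eigenvalues {δ κ : ℝ} (hδ : IsNonresonant δ κ) {q : C(Circ, ℂ)}
    (hq : star q = q) {c B : ℝ} (hc : circleCoeff 0 q = c)
    (hB : ∀ m : ℤ, |(m : ℝ)| * ‖circleCoeff m q‖ ≤ B) :
    ∃ (C T : ℝ) (ℓ : ℕ) (lam : ℤ → ℝ) (h : ℤ → C(Circ, ℂ)), 0 < C ∧ 1 ≤ ℓ ∧
      (∀ j : ℤ, (ℓ : ℤ) ≤ |j| → |lam j - (c + ((j : ℝ) + δ) ^ 2)| ≤ C / |(j : ℝ)| ^ 2 ∧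
        ‖h j‖ ≤ C / |(j : ℝ)| ∧ circleCoeff j (h j) = 0 ∧
        IsFourierEigen δ q (lam j) (fourier j + h j)) ∧
      Set.InjOn lam {j | (ℓ : ℤ) ≤ |j|} ∧
      fourierSpectrum δ q ∩ Set.Ioi T = lam '' {j | (ℓ : ℤ) ≤ |j|} := by
  obtain ⟨C, hC, N, hN, hpert⟩ := exists_perturbed_eigenpair hδ hq hc hB
  have hκ := hδ.pos
  have hM := norm_nonneg q
  -- One window for both purposes: every eigenvalue is within `‖q‖` of some `(n + δ)²`, and `lam j`
  -- is within `|c| + 1` of `(j + δ)²`.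
  set W : ℝ := ‖q‖ + |c| + 1 with hW
  have hW0 : 0 < W := by positivity
  -- The summands secure, in turn, existence of the perturbed pairs, `‖h j‖ ≤ 1/2`, windows small
  -- compared with the gap, and `ℓ ≥ 2`.
  obtain ⟨ℓ, hℓ⟩ := exists_nat_ge (N + 2 * C + 4 * (W + ‖q‖ + 1) / κ + 2)
  have hX : 0 ≤ 4 * (W + ‖q‖ + 1) / κ := by positivity
  have hℓN : N ≤ ℓ := by linarith
  have hℓC : 2 * C ≤ ℓ := by linarith
  have hℓ2 : (2 : ℝ) ≤ ℓ := by linarith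
  have hℓW : 2 * (W + ‖q‖ + 1) ≤ κ / 2 * ℓ := by
    have : 4 * (W + ‖q‖ + 1) / κ ≤ ℓ := by linarith
    rw [div_le_iff₀ hκ] at this
    linarith
  have hcast : ∀ j : ℤ, (ℓ : ℤ) ≤ |j| → (ℓ : ℝ) ≤ |(j : ℝ)| := fun j hj => by exact_mod_cast hj
  have hne : ∀ j : ℤ, (ℓ : ℤ) ≤ |j| → j ≠ 0 := by
    rintro j hj rfl
    have := hcast 0 hj
    rw [Int.cast_zero, abs_zero] at this
    linarith
  choose! ε h hh hε hhj heig using fun (j : ℤ) (hj : (ℓ : ℤ) ≤ |j|) => hpert j (hℓN.trans (hcast j hj))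
  set lam : ℤ → ℝ := fun j => c + ((j : ℝ) + δ) ^ 2 + ε j with hlam
  have hh2 : ∀ j : ℤ, (ℓ : ℤ) ≤ |j| → ‖h j‖ ≤ 1 / 2 := by
    intro j hj
    have h1 := hcast j hj
    refine (hh j hj).trans ?_
    rw [div_le_div_iff₀ (by linarith) two_pos]
    linarith
  have hε1 : ∀ j : ℤ, (ℓ : ℤ) ≤ |j| → |ε j| ≤ 1 := by
    intro j hj
    have h1 := hcast j hj
    refine (hε j hj).trans ?_
    rw [div_le_one (pow_pos (by linarith) 2)]
    nlinarith
  have hlamW : ∀ j : ℤ, (ℓ : ℤ) ≤ |j| → |lam j - ((j : ℝ) + δ) ^ 2| ≤ W := by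
    intro j hj
    have e : lam j - ((j : ℝ) + δ) ^ 2 = c + ε j := by simp only [hlam]; ring
    rw [e]
    refine (abs_add_le _ _).trans ?_
    linarith [hε1 j hj]
  have hgap : ∀ j : ℤ, (ℓ : ℤ) ≤ |j| → 2 * (W + ‖q‖ + 1) ≤ κ / 2 * |(j : ℝ)| := by
    intro j hj
    refine hℓW.trans ?_
    have := hcast j hj
    gcongr
  have hg0 : ∀ j : ℤ, (ℓ : ℤ) ≤ |j| → (fourier j + h j : C(Circ, ℂ)) ≠ 0 := by
    intro j hj h0
    have h1 : circleCoeff j (fourier j + h j : C(Circ, ℂ)) = 1 := by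
      rw [map_add, hhj j hj, circleCoeff_fourier]; simp
    rw [h0, map_zero] at h1
    exact zero_ne_one h1
  -- A different eigenvalue in the window would have an eigenfunction orthogonal to `fourier j + h
  -- j`, against `inner_fourier_add_ne_zero`.
  have huniq : ∀ t ∈ fourierSpectrum δ q, ∀ j : ℤ, (ℓ : ℤ) ≤ |j| →
      |t - ((j : ℝ) + δ) ^ 2| ≤ W → t = lam j := by
    rintro t ⟨v, h0, hv⟩ j hj htj
    by_contra hcon
    refine hv.inner_fourier_add_ne_zero hδ (hne j hj) h0 (W := W) ?_ ?_ (hh2 j hj)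
      ((heig j hj).inner_eq_zero hq (Ne.symm hcon) hv)
    · rwa [← Complex.ofReal_sub, Complex.norm_real, Real.norm_eq_abs]
    · have := hgap j hj
      linarith
  -- Nonresonance at `±1` keeps `δ` off `±1/2`. Hence the cut `T = (ℓ - 1/2)²` separates the windows
  -- with `|n| ≤ ℓ - 1` from those with `|n| ≥ ℓ`.
  have hδ1 : κ ≤ 1 - 2 * |δ| := by
    have h1 := hδ.le_abs 1
    have h2 := hδ.le_abs (-1)
    have h3 := abs_le.mp hδ.abs_le
    push_cast at h1 h2
    rw [abs_of_nonneg (by linarith)] at h1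
    rw [abs_of_nonpos (by linarith)] at h2
    rcases abs_cases δ with h4 | h4 <;> linarith
  set T : ℝ := ((ℓ : ℝ) - 1 / 2) ^ 2 with hT
  have hδ0 := abs_nonneg δ
  refine ⟨C, T, ℓ, lam, h, hC, ?_, fun j hj => ⟨?_, hh j hj, hhj j hj, heig j hj⟩, ?_, ?_⟩
  · have : (1 : ℝ) ≤ ℓ := by linarith
    exact_mod_cast this
  · have e : lam j - (c + ((j : ℝ) + δ) ^ 2) = ε j := by simp only [hlam]; ring
    rw [e]
    exact hε j hj
  · intro j hj n hn hjn
    by_contra hcon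
    have h1 := hlamW j hj
    have h2 := hlamW n hn
    rw [← hjn] at h2
    have h3 := hδ.gap (hne j hj) (Ne.symm hcon)
    have h4 := hgap j hj
    have h5 := abs_sub (lam j - ((n : ℝ) + δ) ^ 2) (lam j - ((j : ℝ) + δ) ^ 2)
    have e : lam j - ((n : ℝ) + δ) ^ 2 - (lam j - ((j : ℝ) + δ) ^ 2)
      = ((j : ℝ) + δ) ^ 2 - ((n : ℝ) + δ) ^ 2 := by ring
    rw [e] at h5
    linarith
  · ext t
    constructor
    · rintro ⟨ht, htT⟩
      obtain ⟨n, hn⟩ := abs_sub_le_of_mem_fourierSpectrum ht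
      have hnℓ : (ℓ : ℤ) ≤ |n| := by
        by_contra hcon
        have h1 : |n| + 1 ≤ (ℓ : ℤ) := by omega
        have h2 : |(n : ℝ)| + 1 ≤ ℓ := by exact_mod_cast h1
        have h3 : |(n : ℝ) + δ| ≤ ℓ - 1 + |δ| := (abs_add_le _ _).trans (by linarith)
        have h4 : ((n : ℝ) + δ) ^ 2 ≤ (ℓ - 1 + |δ|) ^ 2 := by
          rw [← sq_abs]
          exact pow_le_pow_left₀ (abs_nonneg _) h3 2
        have h5 := (abs_le.mp hn).2
        have h6 : T < t := htT
        rw [hT] at h6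
        nlinarith
      exact ⟨n, hnℓ, (huniq t ht n hnℓ (hn.trans (by linarith [abs_nonneg c]))).symm⟩
    · rintro ⟨j, hj, rfl⟩
      refine ⟨⟨_, hg0 j hj, heig j hj⟩, ?_⟩
      have h1 := hcast j hj
      have h2 := abs_sub_abs_le_abs_sub (j : ℝ) (-δ)
      rw [abs_neg, sub_neg_eq_add] at h2
      have h3 : (ℓ - |δ|) ^ 2 ≤ ((j : ℝ) + δ) ^ 2 := by
        rw [← sq_abs ((j : ℝ) + δ)]
        exact pow_le_pow_left₀ (by linarith) (by linarith) 2
      have h4 := (abs_le.mp (hlamW j hj)).1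
      change T < lam j
      rw [hT]
      nlinarith

section

variable {Avec : UnitCircle → Plane} {a : UnitCircle → ℝ} {δ κ : ℝ}

theorem isEigenvalueSequence_of_range_eq (hA : Continuous Avec) (ha : Continuous a) {m : ℤ}
    (hm : avgA Avec = δ + m) (hδ : ∀ n : ℤ, 2 * δ ≠ n) {μ : ℕ → ℝ} (hμ : StrictMono μ)
    (hr : Set.range μ = fourierSpectrum δ (circlePotential a ha)) (ht : Tendsto μ atTop atTop) :
    IsEigenvalueSequence Avec a μ := by
  refine ⟨hμ.monotone, ht, fun t => (finite_and_finrank_eigenspaceL hA ha hm hδ t).1, fun t => ?_⟩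
  obtain ⟨-, h1, h2⟩ := finite_and_finrank_eigenspaceL hA ha hm hδ t
  rw [← hr] at h1 h2
  by_cases h : t ∈ Set.range μ
  · rw [h1 h]
    obtain ⟨k, rfl⟩ := h
    have : {k' | μ k' = μ k} = {k} := by
      ext k'
      simp [hμ.injective.eq_iff]
    rw [this, Set.ncard_singleton]
  · rw [h2 h]
    have : {k | μ k = t} = ∅ := by
      ext k
      simp only [Set.mem_ofPred_eq, Set.mem_empty_iff_false, iff_false]
      exact fun hk => h ⟨k, hk⟩
    rw [this, Set.ncard_empty]

/-- The coefficient at `j` is exactly one, so the norm of `fourier j + h` lies between `1` and `1 +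
‖h‖`, and normalization costs no more than `h` itself. -/
theorem norm_inv_norm_smul_sub_le {j : ℤ} {h : C(Circ, ℂ)} (hj : circleCoeff j h = 0) (x : Circ) :
    ‖((‖circleL2 (fourier j + h)‖⁻¹ : ℝ) : ℂ) * (fourier j + h : C(Circ, ℂ)) x - (fourier j : C(Circ, ℂ)) x‖ ≤ 2 * ‖h‖ := by
  set n := ‖circleL2 (fourier j + h)‖ with hn
  have h1 : 1 ≤ n := by
    have e : circleCoeff j (fourier j + h) = 1 := by
      rw [map_add, hj, circleCoeff_fourier]; simp
    have := norm_circleCoeff_le (fourier j + h) j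
    rwa [e, norm_one] at this
  have h2 : n ≤ 1 + ‖h‖ := by
    rw [hn, map_add]
    refine (norm_add_le _ _).trans ?_
    rw [circleL2_fourier_norm]
    linarith [norm_circleL2_le h]
  have hpos : 0 < n := by linarith
  have hx : ‖(fourier j : C(Circ, ℂ)) x‖ ≤ 1 :=
    ((fourier j : C(Circ, ℂ)).norm_coe_le_norm x).trans (fourier_norm j).le
  have e : ((n⁻¹ : ℝ) : ℂ) * (fourier j + h : C(Circ, ℂ)) x - (fourier j : C(Circ, ℂ)) x
      = ((n⁻¹ - 1 : ℝ) : ℂ) * (fourier j : C(Circ, ℂ)) x + ((n⁻¹ : ℝ) : ℂ) * h x := by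
    rw [ContinuousMap.add_apply]
    push_cast
    ring
  have hi1 : n⁻¹ ≤ 1 := inv_le_one_of_one_le₀ h1
  have hi0 : 0 < n⁻¹ := inv_pos.mpr hpos
  have hi2 : |n⁻¹ - 1| ≤ ‖h‖ := by
    rw [abs_of_nonpos (by linarith)]
    have : n⁻¹ * n = 1 := inv_mul_cancel₀ hpos.ne'
    nlinarith [norm_nonneg h]
  rw [e]
  refine (norm_add_le _ _).trans ?_
  rw [norm_mul, norm_mul, Complex.norm_real, Complex.norm_real, Real.norm_eq_abs, Real.norm_eq_abs,
    abs_of_pos hi0]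
  have a1 : |n⁻¹ - 1| * ‖(fourier j : C(Circ, ℂ)) x‖ ≤ ‖h‖ * 1 :=
    mul_le_mul hi2 hx (norm_nonneg _) (norm_nonneg _)
  have a2 : n⁻¹ * ‖h x‖ ≤ 1 * ‖h‖ :=
    mul_le_mul hi1 (h.norm_coe_le_norm x) (norm_nonneg _) zero_le_one
  linarith

/-- Transports the spectral description on the circle back through the gauge. Simplicity of the
eigenvalues makes the enumeration strictly increasing. -/
theorem exists_isHighSpectrum (hA : Continuous Avec) (ha : Continuous a)
    (ha' : ∃ C, LipschitzWith C a) (hδeq : δ = avgA Avec - ⌊avgA Avec + 1 / 2⌋)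
    (hδ : IsNonresonant δ κ) :
    ∃ μ : ℕ → ℝ, IsEigenvalueSequence Avec a μ ∧
      ∃ (kstar ℓ : ℕ) (lam : ℤ → ℝ) (φ : ℤ → UnitCircle → ℂ) (R : ℤ → ℝ → ℂ),
        IsHighSpectrum Avec a μ kstar ℓ lam φ R := by
  have hm : avgA Avec = δ + ⌊avgA Avec + 1 / 2⌋ := by rw [hδeq]; ring
  have h2δ : ∀ n : ℤ, 2 * δ ≠ n := by
    intro n h
    have := hδ.le_abs (-n)
    rw [h] at this
    simp at this
    linarith [hδ.pos]
  have hδ' : ∀ n : ℤ, δ ≠ n := fun n h => h2δ (2 * n) (by rw [h]; push_cast; ring)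
  set q := circlePotential a ha with hqdef
  have hq : star q = q := star_circlePotential ha
  obtain ⟨B, hB⟩ := exists_circleCoeff_circlePotential_le ha' ha
  obtain ⟨C, T, ℓ, lam, h, hC, hℓ, hlam, hinj, himage⟩ :=
    exists_large_eigenvalues hδ hq (circleCoeff_zero_circlePotential ha) hB
  have hjne : ∀ j : ℤ, (ℓ : ℤ) ≤ |j| → j ≠ 0 := by
    rintro j hj rfl
    simp at hj
    omega
  have hjpos : ∀ j : ℤ, (ℓ : ℤ) ≤ |j| → 0 < |(j : ℝ)| := fun j hj =>
    abs_pos.mpr (by exact_mod_cast hjne j hj)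
  have hSinf : (fourierSpectrum δ q).Infinite := by
    have h1 : (lam '' {j | (ℓ : ℤ) ≤ |j|}).Infinite := by
      refine Set.Infinite.image hinj ?_
      refine (Set.Ici_infinite (ℓ : ℤ)).mono fun j hj => ?_
      exact le_trans hj (le_abs_self j)
    rw [← himage] at h1
    exact h1.mono Set.inter_subset_left
  obtain ⟨μ, hμ, hr, ht⟩ := exists_strictMono_range_eq hSinf
    (fourierSpectrum_inter_Iic_finite hδ.abs_le hq)
  refine ⟨μ, isEigenvalueSequence_of_range_eq hA ha hm h2δ hμ hr ht, ?_⟩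
  obtain ⟨k0, hk0⟩ := (ht.eventually_gt_atTop T).exists
  classical
  -- `kstar` is the first index with eigenvalue above the cut `T`.
  have hex : ∃ k, T < μ k := ⟨k0, hk0⟩
  have hkstar : ∀ k, Nat.find hex ≤ k ↔ T < μ k := by
    intro k
    constructor
    · exact fun hk => (Nat.find_spec hex).trans_le (hμ.monotone hk)
    · exact fun hk => Nat.find_min' hex hk
  set g : ℤ → C(Circ, ℂ) := fun j => fourier j + h j with hg
  set n : ℤ → ℝ := fun j => ‖circleL2 (g j)‖ with hn
  set s : ℝ := 1 / √(2 * Real.pi) with hs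
  have hg0 : ∀ j : ℤ, (ℓ : ℤ) ≤ |j| → n j ≠ 0 := by
    intro j hj h0
    have h1 : circleCoeff j (g j) = 1 := by
      rw [hg, map_add, (hlam j hj).2.2.1, circleCoeff_fourier]; simp
    have h2 := norm_circleCoeff_le (g j) j
    rw [h1, norm_one] at h2
    have h3 : n j = ‖circleL2 (g j)‖ := rfl
    linarith
  choose φ hφ using fun j => exists_eq_gaugeFactor_mul hA hm (((s * (n j)⁻¹ : ℝ) : ℂ) • g j)
  -- The gauge factor is `exp (-i (⌊Ã + 1/2⌋ θ + ∫₀^θ A)) * exp (iÃθ)`; the remainder is the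
  -- deviation of the normalized eigenfunction from `fourier j`, times `exp (iÃθ)`.
  refine ⟨Nat.find hex, ℓ, lam, φ, fun j θ => Complex.exp (Complex.I * ((avgA Avec * θ : ℝ) : ℂ)) *
    ((((n j)⁻¹ : ℝ) : ℂ) * g j (θ : Circ) - (fourier j : C(Circ, ℂ)) (θ : Circ)), ?_⟩
  constructor
  · rw [← himage, ← hr]
    ext t
    constructor
    · rintro ⟨k, hk, rfl⟩
      exact ⟨⟨k, rfl⟩, (hkstar k).mp hk⟩
    · rintro ⟨⟨k, rfl⟩, hk⟩
      exact ⟨k, (hkstar k).mpr hk, rfl⟩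
  · exact hμ.injective.injOn
  · exact hinj
  · refine IsBigO.of_bound (2 * C) ?_
    filter_upwards [eventually_cofinite_le_abs ℓ] with j hj
    have h1 := (hlam j hj).1
    have hj0 := hjpos j hj
    rw [← hδeq, sign_mul_add_abs_eq hδ.abs_le (hjne j hj)]
    set ε := lam j - (avga a + ((j : ℝ) + δ) ^ 2) with hε
    set x := |(j : ℝ) + δ| with hx
    have e : lam j - avga a = x ^ 2 + ε := by rw [hx, sq_abs, hε]; ring
    rw [e]
    -- The root gains a factor `1 / |j + δ| ≤ 2 / |j|` over the `O(j⁻²)` error of `lam j`.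
    have h2 := abs_sqrt_sub_mul_le (x := x) (ε := ε) (abs_nonneg _)
    have h3 := abs_sub_abs_le_abs_sub (j : ℝ) (-δ)
    rw [abs_neg, sub_neg_eq_add] at h3
    have h4 : (1 : ℝ) ≤ |(j : ℝ)| := by exact_mod_cast Int.one_le_abs (hjne j hj)
    have h5 : |(j : ℝ)| / 2 ≤ x := by linarith [hδ.abs_le]
    rw [Real.norm_eq_abs, Real.norm_eq_abs, abs_of_nonneg (a := 1 / |(j : ℝ)| ^ 3) (by positivity)]
    set X := |√(x ^ 2 + ε) - x|
    have hX : 0 ≤ X := abs_nonneg _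
    have h6 : X * (|(j : ℝ)| / 2) ≤ C / |(j : ℝ)| ^ 2 :=
      (mul_le_mul_of_nonneg_left h5 hX).trans (h2.trans h1)
    have h7 : 2 * C * (1 / |(j : ℝ)| ^ 3) = (C / |(j : ℝ)| ^ 2) * (2 / |(j : ℝ)|) := by
      field_simp
    have h8 : X = X * (|(j : ℝ)| / 2) * (2 / |(j : ℝ)|) := by
      field_simp
    rw [h7, h8]
    gcongr
  · refine IsBigO.of_bound C ?_
    filter_upwards [eventually_cofinite_le_abs ℓ] with j hj
    have h1 := (hlam j hj).1
    have e : (j : ℝ) + avgA Avec - (⌊avgA Avec + 1 / 2⌋ : ℝ) = (j : ℝ) + δ := by rw [hδeq]; ring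
    rw [e, Real.norm_eq_abs, Real.norm_eq_abs, abs_of_nonneg (a := 1 / (j : ℝ) ^ 2) (by positivity),
      mul_one_div, ← sq_abs (j : ℝ)]
    exact h1
  · intro j hj
    refine ⟨(mem_eigenspaceL_iff hA ha hm hδ').mpr ⟨_, ((hlam j hj).2.2.2).smul _, hφ j⟩, ?_⟩
    rw [integral_norm_sq_comp_pt (hφ j), map_smul, norm_smul, Complex.norm_real, Real.norm_eq_abs]
    have h1 : 0 < n j := lt_of_le_of_ne (norm_nonneg _) (hg0 j hj).symm
    have h2 : 0 < s := by positivity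
    rw [abs_of_pos (by positivity)]
    have h3 : ‖circleL2 (g j)‖ = n j := rfl
    rw [h3, inv_mul_cancel_right₀ h1.ne', hs, div_pow, Real.sq_sqrt (by positivity)]
    have := Real.pi_ne_zero
    field_simp
  · intro j hj θ
    rw [hφ j θ, ContinuousMap.smul_apply, smul_eq_mul]
    have e1 : Complex.exp (Complex.I * (((avgA Avec + j) * θ : ℝ) : ℂ))
        = Complex.exp (Complex.I * ((avgA Avec * θ : ℝ) : ℂ)) * (fourier j : C(Circ, ℂ)) (θ : Circ) := by
      rw [circle_fourier_coe, ← Complex.exp_add]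
      congr 1
      push_cast
      ring
    have e2 : gaugeFactor (angularComponent Avec) δ θ
        = Complex.exp (-Complex.I * (((⌊avgA Avec + 1 / 2⌋ : ℝ) * θ
          + ∫ t in (0 : ℝ)..θ, angularComponent Avec t : ℝ) : ℂ))
          * Complex.exp (Complex.I * ((avgA Avec * θ : ℝ) : ℂ)) := by
      rw [gaugeFactor, ← Complex.exp_add]
      congr 1
      have hc : ((avgA Avec : ℝ) : ℂ) = δ + ((⌊avgA Avec + 1 / 2⌋ : ℝ) : ℂ) := by
        exact_mod_cast hm
      push_cast at hc ⊢
      linear_combination (-Complex.I * θ) * hc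
    rw [e1, e2, hs]
    push_cast
    ring
  · refine ⟨2 * C, ?_⟩
    filter_upwards [eventually_cofinite_le_abs ℓ] with j hj θ
    have h1 := norm_inv_norm_smul_sub_le (hlam j hj).2.2.1 (θ : Circ)
    have h2 : ‖Complex.exp (Complex.I * ((avgA Avec * θ : ℝ) : ℂ))‖ = 1 := by
      rw [mul_comm, Complex.norm_exp_ofReal_mul_I]
    rw [norm_mul, h2, one_mul, mul_div_assoc]
    exact h1.trans (by linarith [(hlam j hj).2.1])

end

/-! ### Bounds for Bessel functions of large order -/

theorem besselJ_zero_right {ν : ℝ} (hν : 0 < ν) : besselJ ν 0 = 0 := by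
  simp [besselJ, Real.zero_rpow hν.ne']

/-- `Γ` increases on `[2, ∞)`, so for `ν ≥ 1` each `Γ(k + ν + 1)` may be replaced by `Γ(ν + 1)`,
leaving an exponential series. -/
theorem abs_besselJ_le {ν t : ℝ} (hν : 1 ≤ ν) (ht : 0 ≤ t) :
    |besselJ ν t| ≤ (t / 2) ^ ν / Real.Gamma (ν + 1) * Real.exp ((t / 2) ^ 2) := by
  have hx : 0 ≤ t / 2 := by positivity
  set x := t / 2
  have hG : 0 < Real.Gamma (ν + 1) := Real.Gamma_pos_of_pos (by linarith)
  have hsum : HasSum (fun k : ℕ => (Real.Gamma (ν + 1))⁻¹ * ((x ^ 2) ^ k / (k.factorial : ℝ)))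
      ((Real.Gamma (ν + 1))⁻¹ * Real.exp (x ^ 2)) := by
    refine HasSum.mul_left _ ?_
    rw [Real.exp_eq_exp_ℝ]
    exact NormedSpace.expSeries_div_hasSum_exp (x ^ 2)
  have hle : |∑' k : ℕ, (-1 : ℝ) ^ k / (Real.Gamma (k + 1) * Real.Gamma (k + ν + 1)) * x ^ (2 * k)|
      ≤ (Real.Gamma (ν + 1))⁻¹ * Real.exp (x ^ 2) := by
    rw [← Real.norm_eq_abs]
    refine tsum_of_norm_bounded hsum fun k => ?_
    have hk : (0 : ℝ) ≤ k := Nat.cast_nonneg k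
    have hmono : Real.Gamma (ν + 1) ≤ Real.Gamma (k + ν + 1) :=
      Real.Gamma_strictMonoOn_Ici.monotoneOn (by simp; linarith) (by simp; linarith) (by linarith)
    have hf : (0 : ℝ) < k.factorial := by exact_mod_cast Nat.factorial_pos k
    rw [Real.Gamma_nat_eq_factorial, norm_mul, norm_div, norm_pow, norm_neg, norm_one, one_pow,
      Real.norm_of_nonneg (mul_nonneg hf.le (hG.le.trans hmono)),
      Real.norm_of_nonneg (pow_nonneg hx _), pow_mul]
    calc 1 / ((k.factorial : ℝ) * Real.Gamma (k + ν + 1)) * (x ^ 2) ^ k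
        ≤ 1 / ((k.factorial : ℝ) * Real.Gamma (ν + 1)) * (x ^ 2) ^ k := by gcongr
      _ = _ := by field_simp
  rw [besselJ, abs_mul, abs_of_nonneg (Real.rpow_nonneg hx ν), div_mul_eq_mul_div, mul_div_assoc]
  refine mul_le_mul_of_nonneg_left (hle.trans (le_of_eq ?_)) (Real.rpow_nonneg hx ν)
  rw [inv_mul_eq_div]

/-- Super-exponential decay of `x ^ ν / Γ(ν + 1)`. -/
theorem rpow_div_Gamma_le {ν x : ℝ} (hν : 1 ≤ ν) (hx : 0 ≤ x) :
    x ^ ν / Real.Gamma (ν + 1) ≤ (x + 1) * Real.exp (4 * (x + 1)) * (1 / 4) ^ ⌊ν⌋₊ := by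
  set n := ⌊ν⌋₊ with hn
  have hn1 : (n : ℝ) ≤ ν := Nat.floor_le (by linarith)
  have hn2 : ν ≤ (n : ℝ) + 1 := (Nat.lt_floor_add_one ν).le
  have hn3 : (1 : ℝ) ≤ n := by exact_mod_cast Nat.le_floor (by simpa using hν)
  have hf : (0 : ℝ) < n.factorial := by exact_mod_cast Nat.factorial_pos n
  have hΓ : (n.factorial : ℝ) ≤ Real.Gamma (ν + 1) := by
    rw [← Real.Gamma_nat_eq_factorial]
    exact Real.Gamma_strictMonoOn_Ici.monotoneOn (by simp; linarith) (by simp; linarith)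
      (by linarith)
  have h1 : x ^ ν ≤ (x + 1) ^ (n + 1) := by
    calc x ^ ν ≤ (x + 1) ^ ν := Real.rpow_le_rpow hx (by linarith) (by linarith)
      _ ≤ (x + 1) ^ ((n : ℝ) + 1) := Real.rpow_le_rpow_of_exponent_le (by linarith) hn2
      _ = _ := by
        rw [← Real.rpow_natCast]
        push_cast
        rfl
  -- Evaluating at `4 * (x + 1)` instead of `x + 1` leaves the geometric factor `(1/4)^n`.
  have h2 := Real.pow_div_factorial_le_exp (x := 4 * (x + 1)) (by positivity) n
  calc x ^ ν / Real.Gamma (ν + 1) ≤ (x + 1) ^ (n + 1) / n.factorial := by gcongr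
    _ = (x + 1) * ((4 * (x + 1)) ^ n / n.factorial) * (1 / 4) ^ n := by
      rw [mul_pow, pow_succ, div_pow, one_pow]
      field_simp
    _ ≤ _ := by gcongr

theorem norm_I_cpow_neg_ofReal (β : ℝ) : ‖Complex.I ^ (-(β : ℂ))‖ = 1 := by
  rw [Complex.norm_cpow_of_ne_zero Complex.I_ne_zero]
  simp

theorem norm_radialFactor (s t : ℝ) : ‖radialFactor s t‖ = |besselJ (√s) t| := by
  rw [radialFactor, norm_mul, betaExp, alphaExp, norm_I_cpow_neg_ofReal, one_mul, neg_neg,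
    Complex.norm_real, Real.norm_eq_abs]

theorem radialFactor_zero_right {s : ℝ} (hs : 0 < s) : radialFactor s 0 = 0 := by
  rw [radialFactor, alphaExp, neg_neg, besselJ_zero_right (Real.sqrt_pos.mpr hs)]
  simp

theorem summable_half_pow_natAbs : Summable fun j : ℤ => (1 / 2 : ℝ) ^ j.natAbs := by
  have h : Summable fun n : ℕ => (1 / 2 : ℝ) ^ n := summable_geometric_two
  refine Summable.of_nat_of_neg ?_ ?_
  · simpa using h
  · simpa using h

/-- The radial factors decay geometrically along a sequence growing quadratically. -/
theorem exists_norm_radialFactor_le {lam : ℤ → ℝ}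
    (hlam : ∀ᶠ j : ℤ in cofinite, ((j : ℝ) / 2) ^ 2 ≤ lam j) {t : ℝ} (ht : 0 ≤ t) :
    ∃ D : ℝ, 0 ≤ D ∧ ∀ᶠ j : ℤ in cofinite, ‖radialFactor (lam j) t‖ ≤ D * (1 / 2) ^ j.natAbs := by
  refine ⟨(t / 2 + 1) * Real.exp (4 * (t / 2 + 1)) * 4 * Real.exp ((t / 2) ^ 2), by positivity, ?_⟩
  filter_upwards [hlam, eventually_cofinite_le_abs 2] with j hj hj2
  have hj2' : (2 : ℝ) ≤ |(j : ℝ)| := by exact_mod_cast hj2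
  set ν := √(lam j) with hν
  have hνj : |(j : ℝ)| / 2 ≤ ν := by
    rw [hν, ← abs_two, ← abs_div]
    exact Real.abs_le_sqrt hj
  have hν1 : 1 ≤ ν := by linarith
  rw [norm_radialFactor]
  refine (abs_besselJ_le hν1 ht).trans ?_
  have h1 := rpow_div_Gamma_le hν1 (by positivity : 0 ≤ t / 2)
  -- From `|j| / 2 ≤ ν` follows `|j| ≤ 2⌊ν⌋ + 2`; the `2` costs the factor `4`.
  have h2 : (1 / 4 : ℝ) ^ ⌊ν⌋₊ ≤ 4 * (1 / 2) ^ j.natAbs := by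
    have h3 : j.natAbs ≤ 2 * ⌊ν⌋₊ + 2 := by
      have h4 := (Nat.lt_floor_add_one ν).le
      have h5 : (j.natAbs : ℝ) = |(j : ℝ)| := by rw [Nat.cast_natAbs, Int.cast_abs]
      have h6 : (j.natAbs : ℝ) ≤ 2 * ⌊ν⌋₊ + 2 := by linarith
      exact_mod_cast h6
    have h4 : (1 / 2 : ℝ) ^ (2 * ⌊ν⌋₊ + 2) ≤ (1 / 2) ^ j.natAbs :=
      pow_le_pow_of_le_one (by norm_num) (by norm_num) h3
    have h5 : (1 / 2 : ℝ) ^ (2 * ⌊ν⌋₊ + 2) = (1 / 4) * (1 / 4) ^ ⌊ν⌋₊ := by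
      rw [pow_add, pow_mul]; norm_num; ring
    linarith
  calc _ ≤ ((t / 2 + 1) * Real.exp (4 * (t / 2 + 1)) * (1 / 4) ^ ⌊ν⌋₊) * Real.exp ((t / 2) ^ 2) := by
        gcongr
    _ ≤ ((t / 2 + 1) * Real.exp (4 * (t / 2 + 1)) * (4 * (1 / 2) ^ j.natAbs))
        * Real.exp ((t / 2) ^ 2) := by gcongr
    _ = _ := by ring

/-! ### Convergence and re-indexing of the kernel series -/

theorem norm_coe_pt (θ : ℝ) : ‖(pt θ : Plane)‖ = 1 := by simp

theorem direction_smul_pt {r : ℝ} (hr : 0 < r) (θ : ℝ) : direction (r • (pt θ : Plane)) = pt θ := by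
  have h0 : (pt θ : Plane) ≠ 0 := by
    intro h
    have := norm_coe_pt θ
    rw [h, norm_zero] at this
    exact zero_ne_one this
  have h : r • (pt θ : Plane) ≠ 0 := smul_ne_zero hr.ne' h0
  rw [direction, dif_neg h]
  apply Subtype.ext
  simp only [norm_smul, norm_coe_pt, Real.norm_of_nonneg hr.le, mul_one, smul_smul,
    inv_mul_cancel₀ hr.ne', one_smul]

/-- At the origin the direction is an arbitrary point, but both sides vanish: a Bessel function of
positive order is zero at `0`. This uses the positivity of the eigenvalue. -/
theorem kernelTerm_smul_pt {μ : ℕ → ℝ} (ψ : ℕ → UnitCircle → ℂ) {r r' : ℝ} (hr : 0 ≤ r)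
    (hr' : 0 ≤ r') (θ θ' : ℝ) {k : ℕ} (hk : 0 < μ k) :
    kernelTerm μ ψ (r • (pt θ : Plane)) (r' • (pt θ' : Plane)) k
      = radialFactor (μ k) (r * r') * ψ k (pt θ) * conj (ψ k (pt θ')) := by
  have hn : ∀ {r : ℝ} (_ : 0 ≤ r) (θ : ℝ), ‖r • (pt θ : Plane)‖ = r := by
    intro r hr θ
    rw [norm_smul, norm_coe_pt, mul_one, Real.norm_of_nonneg hr]
  rw [kernelTerm, hn hr, hn hr']
  rcases hr.eq_or_lt with rfl | h
  · simp only [zero_mul, radialFactor_zero_right hk]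
  rcases hr'.eq_or_lt with rfl | h'
  · simp only [mul_zero, radialFactor_zero_right hk, zero_mul]
  rw [direction_smul_pt h, direction_smul_pt h']

namespace IsHighSpectrum

variable {Avec : UnitCircle → Plane} {a : UnitCircle → ℝ} {μ : ℕ → ℝ} {kstar ℓ : ℕ} {lam : ℤ → ℝ}
  {φ : ℤ → UnitCircle → ℂ} {R : ℤ → ℝ → ℂ}

theorem eventually_sq_le (H : IsHighSpectrum Avec a μ kstar ℓ lam φ R) :
    ∀ᶠ j : ℤ in cofinite, ((j : ℝ) / 2) ^ 2 ≤ lam j := by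
  obtain ⟨C, hC⟩ := H.asymp.bound
  set δ : ℝ := avgA Avec - (⌊avgA Avec + 1 / 2⌋ : ℝ) with hδ
  obtain ⟨L, hL⟩ := exists_nat_ge (4 * |δ| + 4 * |C| + 4 * |avga a| + 4)
  filter_upwards [hC, eventually_cofinite_le_abs L] with j h1 h2
  have h3 : (L : ℝ) ≤ |(j : ℝ)| := by exact_mod_cast h2
  have hδ0 := abs_nonneg δ
  have hC0 := abs_nonneg C
  have ha0 := abs_nonneg (avga a)
  have hj1 : 1 ≤ |(j : ℝ)| := by linarith
  have hj2 : 1 ≤ (j : ℝ) ^ 2 := by rw [← sq_abs]; nlinarith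
  have h4 : ‖1 / (j : ℝ) ^ 2‖ ≤ 1 := by
    rw [Real.norm_of_nonneg (by positivity), div_le_one (by linarith)]
    exact hj2
  have h5 : C * ‖1 / (j : ℝ) ^ 2‖ ≤ |C| := by
    refine (mul_le_mul_of_nonneg_right (le_abs_self C) (norm_nonneg _)).trans ?_
    exact mul_le_of_le_one_right hC0 h4
  have e : (j : ℝ) + avgA Avec - (⌊avgA Avec + 1 / 2⌋ : ℝ) = (j : ℝ) + δ := by rw [hδ]; ring
  rw [e, Real.norm_eq_abs] at h1
  have h6 := (abs_le.mp (h1.trans h5)).1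
  have h7 : (|(j : ℝ)| - |δ|) ^ 2 ≤ ((j : ℝ) + δ) ^ 2 := by
    have h8 := abs_sub_abs_le_abs_sub (j : ℝ) (-δ)
    rw [abs_neg, sub_neg_eq_add] at h8
    rw [← sq_abs ((j : ℝ) + δ)]
    exact pow_le_pow_left₀ (by linarith) h8 2
  have h9 := neg_abs_le (avga a)
  have h10 : ((j : ℝ) / 2) ^ 2 = |(j : ℝ)| ^ 2 / 4 := by rw [sq_abs]; ring
  rw [h10]
  nlinarith

/-- The angular factors are bounded uniformly in `j` up to finitely many indices, so the geometric
decay of the radial factors decides. -/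
theorem summable_highTerm (H : IsHighSpectrum Avec a μ kstar ℓ lam φ R) {r r' : ℝ} (hr : 0 ≤ r)
    (hr' : 0 ≤ r') (θ θ' : ℝ) : Summable (highTerm Avec lam R r r' θ θ') := by
  obtain ⟨D, hD, hb⟩ := exists_norm_radialFactor_le H.eventually_sq_le (mul_nonneg hr hr')
  obtain ⟨C, hC⟩ := H.remainder
  refine Summable.of_norm_bounded_eventually
    (summable_half_pow_natAbs.mul_left (D * (1 + |C|) ^ 2)) ?_
  filter_upwards [hb, hC, eventually_cofinite_le_abs 1] with j h1 h2 h3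
  have hj : (1 : ℝ) ≤ |(j : ℝ)| := by exact_mod_cast h3
  have hR : ∀ θ, ‖R j θ‖ ≤ |C| := by
    intro θ
    refine (h2 θ).trans ?_
    refine (div_le_div_of_nonneg_right (le_abs_self C) (by linarith)).trans ?_
    exact div_le_self (abs_nonneg C) hj
  have e1 : ‖Complex.exp (Complex.I * (((avgA Avec + j) * θ : ℝ) : ℂ)) + R j θ‖ ≤ 1 + |C| := by
    refine (norm_add_le _ _).trans (add_le_add (le_of_eq ?_) (hR θ))
    rw [mul_comm, Complex.norm_exp_ofReal_mul_I]
  have e2 : ‖Complex.exp (-Complex.I * (((avgA Avec + j) * θ' : ℝ) : ℂ)) + conj (R j θ')‖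
      ≤ 1 + |C| := by
    refine (norm_add_le _ _).trans (add_le_add (le_of_eq ?_) ?_)
    · rw [Complex.norm_exp]
      simp
    · rw [RCLike.norm_conj]; exact hR θ'
  rw [highTerm, norm_mul, norm_mul]
  calc _ ≤ D * (1 / 2) ^ j.natAbs * (1 + |C|) * (1 + |C|) := by gcongr
    _ = _ := by ring

theorem mul_conj_eq (H : IsHighSpectrum Avec a μ kstar ℓ lam φ R) (hA : Continuous Avec) {j : ℤ}
    (hj : (ℓ : ℤ) ≤ |j|) (r r' θ θ' : ℝ) :
    radialFactor (lam j) (r * r') * φ j (pt θ) * conj (φ j (pt θ'))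
      = ((1 / (2 * Real.pi) : ℝ) : ℂ)
        * Complex.exp (-Complex.I * ((∫ s in θ'..θ, angularComponent Avec s : ℝ) : ℂ))
        * Complex.exp (-Complex.I * (((⌊avgA Avec + 1 / 2⌋ : ℝ) * (θ - θ') : ℝ) : ℂ))
        * highTerm Avec lam R r r' θ θ' j := by
  have hi := (angularComponent_continuous hA).intervalIntegrable (μ := MeasureTheory.volume)
  rw [H.eigen_eq j hj θ, H.eigen_eq j hj θ', highTerm,
    ← intervalIntegral.integral_interval_sub_left (hi 0 θ) (hi 0 θ')]
  set m : ℝ := (⌊avgA Avec + 1 / 2⌋ : ℝ)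
  set u : ℝ := ∫ s in (0 : ℝ)..θ, angularComponent Avec s
  set u' : ℝ := ∫ s in (0 : ℝ)..θ', angularComponent Avec s
  set s : ℝ := 1 / √(2 * Real.pi) with hs
  have hss : ((1 / (2 * Real.pi) : ℝ) : ℂ) = (s : ℂ) * s := by
    rw [← Complex.ofReal_mul, hs, div_mul_div_comm, one_mul, Real.mul_self_sqrt (by positivity)]
  have hconj : ∀ y : ℝ, conj (Complex.exp (-Complex.I * (y : ℂ)))
      = Complex.exp (Complex.I * (y : ℂ)) := by
    intro y
    rw [← Complex.exp_conj]
    simp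
  have hconj' : ∀ y : ℝ, conj (Complex.exp (Complex.I * (y : ℂ)))
      = Complex.exp (-Complex.I * (y : ℂ)) := by
    intro y
    rw [← Complex.exp_conj]
    simp
  have hexp : Complex.exp (-Complex.I * ((u - u' : ℝ) : ℂ))
      * Complex.exp (-Complex.I * ((m * (θ - θ') : ℝ) : ℂ))
      = Complex.exp (-Complex.I * ((m * θ + u : ℝ) : ℂ))
        * Complex.exp (Complex.I * ((m * θ' + u' : ℝ) : ℂ)) := by
    rw [← Complex.exp_add, ← Complex.exp_add]
    congr 1
    push_cast
    ring
  rw [mul_assoc ((1 / (2 * Real.pi) : ℝ) : ℂ), hexp, hss]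
  simp only [map_mul, map_add, hconj, hconj', Complex.conj_ofReal]
  ring

/-- The indices of the large eigenvalues correspond to each other. -/
theorem exists_equiv (H : IsHighSpectrum Avec a μ kstar ℓ lam φ R) :
    ∃ e : {k : ℕ // k ∉ Finset.range kstar} ≃ {j : ℤ // (ℓ : ℤ) ≤ |j|},
      ∀ k : {k : ℕ // k ∉ Finset.range kstar}, μ k = lam (e k) := by
  let e1 := Equiv.Set.imageOfInjOn μ _ H.injOn_mu
  let e2 := Equiv.Set.imageOfInjOn lam _ H.injOn_lam
  let e0 : {k : ℕ // k ∉ Finset.range kstar} ≃ {k : ℕ | kstar ≤ k} :=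
    Equiv.subtypeEquivRight fun k => by simp
  refine ⟨((e0.trans e1).trans (Equiv.setCongr H.image_eq)).trans e2.symm, fun k => ?_⟩
  have h := congrArg Subtype.val (e2.apply_symm_apply (Equiv.setCongr H.image_eq (e1 (e0 k))))
  exact h.symm

/-- The sum over `k` from `kstar` on is transported along the bijection of indices given by equality
of eigenvalues; absolute convergence makes the order irrelevant. -/
theorem kernelK_eq (H : IsHighSpectrum Avec a μ kstar ℓ lam φ R) (hA : Continuous Avec)
    (hμ : ∀ k, 0 < μ k) {ψ : ℕ → UnitCircle → ℂ}
    (hψ : ∀ k, kstar ≤ k → ∀ j : ℤ, (ℓ : ℤ) ≤ |j| → μ k = lam j → ψ k = φ j)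
    {r r' : ℝ} (hr : 0 ≤ r) (hr' : 0 ≤ r') (θ θ' : ℝ) :
    Summable (kernelTerm μ ψ (r • (pt θ : Plane)) (r' • (pt θ' : Plane))) ∧
    Summable (fun j : {j : ℤ // (ℓ : ℤ) ≤ |j|} => highTerm Avec lam R r r' θ θ' j) ∧
    kernelK μ ψ (r • (pt θ : Plane)) (r' • (pt θ' : Plane)) =
      ∑ k ∈ Finset.range kstar, radialFactor (μ k) (r * r') * ψ k (pt θ) * conj (ψ k (pt θ'))
      + ((1 / (2 * Real.pi) : ℝ) : ℂ)
        * Complex.exp (-Complex.I * ((∫ s in θ'..θ, angularComponent Avec s : ℝ) : ℂ))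
        * Complex.exp (-Complex.I * (((⌊avgA Avec + 1 / 2⌋ : ℝ) * (θ - θ') : ℝ) : ℂ))
        * ∑' j : {j : ℤ // (ℓ : ℤ) ≤ |j|}, highTerm Avec lam R r r' θ θ' j := by
  have hs : Summable (fun j : {j : ℤ // (ℓ : ℤ) ≤ |j|} => highTerm Avec lam R r r' θ θ' j) :=
    (H.summable_highTerm hr hr' θ θ').subtype _
  obtain ⟨e, he⟩ := H.exists_equiv
  set c : ℂ := ((1 / (2 * Real.pi) : ℝ) : ℂ)
    * Complex.exp (-Complex.I * ((∫ s in θ'..θ, angularComponent Avec s : ℝ) : ℂ))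
    * Complex.exp (-Complex.I * (((⌊avgA Avec + 1 / 2⌋ : ℝ) * (θ - θ') : ℝ) : ℂ))
  set f := kernelTerm μ ψ (r • (pt θ : Plane)) (r' • (pt θ' : Plane)) with hf
  have hterm : ∀ k : {k : ℕ // k ∉ Finset.range kstar},
      f k = c * highTerm Avec lam R r r' θ θ' (e k) := by
    intro k
    have hk : kstar ≤ (k : ℕ) := by simpa using k.2
    rw [hf, kernelTerm_smul_pt ψ hr hr' θ θ' (hμ k), hψ k hk (e k) (e k).2 (he k), he k]
    exact H.mul_conj_eq hA (e k).2 r r' θ θ'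
  have hfin : HasSum (fun k : {k : ℕ // k ∉ Finset.range kstar} => f k)
      (c * ∑' j : {j : ℤ // (ℓ : ℤ) ≤ |j|}, highTerm Avec lam R r r' θ θ' j) := by
    simp only [hterm]
    exact (e.hasSum_iff (f := fun j : {j : ℤ // (ℓ : ℤ) ≤ |j|} =>
      c * highTerm Avec lam R r r' θ θ' j)).mpr (hs.hasSum.mul_left c)
  have hfs : Summable f := (Finset.summable_compl_iff (Finset.range kstar)).mp hfin.summable
  refine ⟨hfs, hs, ?_⟩
  rw [kernelK, ← hfs.sum_add_tsum_subtype_compl (Finset.range kstar), hfin.tsum_eq]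
  congr 1
  exact Finset.sum_congr rfl fun k _ => kernelTerm_smul_pt ψ hr hr' θ θ' (hμ k)

end IsHighSpectrum

end

theorem corollary2p1
    (Avec : UnitCircle → Plane) (a : UnitCircle → ℝ)
    -- Lipschitz continuity, that is, `W^{1,∞}` on the circle
    (hA : ∃ C, LipschitzWith C Avec) (ha : ∃ C, LipschitzWith C a)
    -- transversality
    (htrans : ∀ ω : UnitCircle, inner ℝ (Avec ω) (ω : Plane) = 0)
    -- the circulation is neither an integer nor a half-integer
    (hres : ∀ m : ℤ, avgA Avec ≠ (m : ℝ) / 2) :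
    ∃ μ : ℕ → ℝ, IsEigenvalueSequence Avec a μ ∧
      (∃ (kstar ℓ : ℕ) (lam : ℤ → ℝ) (φ : ℤ → UnitCircle → ℂ) (R : ℤ → ℝ → ℂ),
        IsHighSpectrum Avec a μ kstar ℓ lam φ R) ∧
      (0 < μ 0 →
        ∀ (kstar ℓ : ℕ) (lam : ℤ → ℝ) (φ : ℤ → UnitCircle → ℂ) (R : ℤ → ℝ → ℂ),
          IsHighSpectrum Avec a μ kstar ℓ lam φ R →
        ∀ ψ : ℕ → UnitCircle → ℂ,
          (∀ k < kstar, IsNormalizedEigenfunction Avec a (μ k) (ψ k)) →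
          (∀ k, kstar ≤ k → ∀ j : ℤ, (ℓ : ℤ) ≤ |j| → μ k = lam j → ψ k = φ j) →
        ∀ (r r' θ θ' : ℝ), 0 ≤ r → 0 ≤ r' →
        ∀ (x y : Plane), x = r • (pt θ : Plane) → y = r' • (pt θ' : Plane) →
          Summable (kernelTerm μ ψ x y) ∧
          Summable (fun j : {j : ℤ // (ℓ : ℤ) ≤ |j|} => highTerm Avec lam R r r' θ θ' j) ∧
          kernelK μ ψ x y =
            ∑ k ∈ Finset.range kstar,
              radialFactor (μ k) (r * r') * ψ k (pt θ) * conj (ψ k (pt θ'))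
            + ((1 / (2 * Real.pi) : ℝ) : ℂ)
              * Complex.exp (-Complex.I * ((∫ s in θ'..θ, angularComponent Avec s : ℝ) : ℂ))
              * Complex.exp (-Complex.I * (((⌊avgA Avec + 1 / 2⌋ : ℝ) * (θ - θ') : ℝ) : ℂ))
              * ∑' j : {j : ℤ // (ℓ : ℤ) ≤ |j|}, highTerm Avec lam R r r' θ θ' j) := by
  obtain ⟨CA, hCA⟩ := hA
  have hAc : Continuous Avec := hCA.continuous
  have hac : Continuous a := ha.choose_spec.continuous
  have hδ : |avgA Avec - (⌊avgA Avec + 1 / 2⌋ : ℝ)| ≤ 1 / 2 := by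
    have h1 := Int.floor_le (avgA Avec + 1 / 2)
    have h2 := Int.lt_floor_add_one (avgA Avec + 1 / 2)
    rw [abs_le]
    constructor <;> linarith
  -- `2δ = m` would make `Ã` half of the integer `2⌊Ã + 1/2⌋ + m`.
  obtain ⟨κ, hκ⟩ := exists_isNonresonant hδ fun m h => by
    refine hres (2 * ⌊avgA Avec + 1 / 2⌋ + m) ?_
    push_cast
    linarith
  obtain ⟨μ, hμ, hhigh⟩ := exists_isHighSpectrum hAc hac ha rfl hκ
  refine ⟨μ, hμ, hhigh, ?_⟩
  rintro hpos kstar ℓ lam φ R H ψ - hψ r r' θ θ' hr hr' x y rfl rfl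
  exact H.kernelK_eq hAc (fun k => hpos.trans_le (hμ.mono (Nat.zero_le k))) hψ hr hr' θ θ'
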